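/- **Setting.** Let $d\ge 2$, $\partial=d/dx$. A *normalized lift* of a curve $\gamma:\mathbb R\to\mathbb{RP}^d$ is a smooth lift $\Gamma:\mathbb R\to\mathbb R^{d+1}$ with $\det(\Gamma,\Gamma',\dots,\Gamma^{(d)})\equiv 1$. We consider curves $\gamma$ that have a normalized lift $\Gamma$ (so $\gamma$ is smooth and nondegenerate) and have monodromy: $\gamma(x+2\pi)=M\cdot\gamma(x)$ for all $x$ and some $M\in \mathrm{PGL}(d+1,\mathbb R)$. Then $L\Gamma=0$ for a unique operator $L=\partial^{d+1}+u_{d-1}\partial^{d-1}+\dots+u_0$, whose coefficients are smooth and $2\pi$-periodic. A *configuration* is $\chi=\{\{p_{1,0},\dots,p_{1,q_1}\},\dots,\{p_{r,0},\dots,p_{r,q_r}\}\}$ with $p_{i,j}\in\mathbb R$, $p_{i,j}\ne p_{i,k}$ for $j\neq k$, $1\le q_i\le d$ and $\sum_i(d-q_i)=d$. For $\epsilon>0$ let $P^i_\epsilon(x)$ be the projective subspace spanned by $\gamma(x+p_{i,0}\epsilon),\dots,\gamma(x+p_{i,q_i}\epsilon)$, and let $T^\chi_\epsilon(\gamma)(x)=\bigcap_{i=1}^rP^i_\epsilon(x)$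 whenever this is a single point. Let $M_0$ be the $d\times d$ matrix with rows indexed by the pairs $(i,j)$, $1\le j\le d-q_i$, and columns by $1\le \ell\le d$, whose entry is the coefficient of $e_0\wedge e_1\wedge\dots\wedge e_{q_i}\wedge e_{q_i+j}$ in $e_\ell\wedge v(p_{i,0})\wedge\dots\wedge v(p_{i,q_i})$, where $e_0,\dots,e_d$ is the standard basis of $\mathbb R^{d+1}$ and $v(p)=\sum_{\beta=0}^d\frac{p^\beta}{\beta!}e_\beta$. The configuration $\chi$ is *nondegenerate* if $M_0$ is invertible. **Theorem.** Let $\chi$ be a nondegenerate configuration. There are real constants $\alpha_{1,1},\alpha_{2,2}$, depending only on $d$ and $\chi$, such that for every curve $\gamma$ as above, with normalized lift $\Gamma$ and operator $L$, the following holds. For all sufficiently small $\epsilon>0$ the point $T^\chi_\epsilon(\gamma)(x)$ is defined for every $x$ and the curve $T_\epsilon^\chi(\gamma)$ has a normalized lift $\Gamma_\epsilon$ (with suitable choice of the global sign when $d$ is odd) such that, as $\epsilon\to0^+$, $$\Gamma_\epsilon=\Gamma+\epsilon\,G_1\Gamma+\epsilon^2G_2\Gamma+O(\epsilon^3)$$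 uniformly for $x$ in compact sets, where $$G_1=\alpha_{1,1}\partial,\qquad G_2=\alpha_{2,2}\Bigl(\partial^2+\frac{2}{d+1}u_{d-1}\Bigr)-\frac{\alpha_{1,1}^2}{d+1}u_{d-1}.$$ In particular, suppose that $\chi$ is *centralized*, i.e. $G_1=0$: the expansion always has the form $\Gamma_\epsilon=\Gamma+\epsilon^2G_2\Gamma+O(\epsilon^3)$. Let $\Gamma(t,x)$ be smooth on $I\times\mathbb R$, with $I\subseteq\mathbb R$ open, such that for each $t\in I$ the curve $\Gamma(t,\cdot)$ is the normalized lift of a curve as above, with operator $L_t$ and corresponding $G_2=G_2(t)$. If $G_2(t)\neq0$ for some $t\in I$ and $\frac{d}{dt}\Gamma=G_2\Gamma$ on $I\times \mathbb R$, then $\alpha_{2,2}\neq0$ and, in the rescaled time $\tau=\alpha_{2,2}t$, the operators solve the $(2,d+1)$-KdV equation $$\frac{d}{d\tau}L=[Q_2,L],\qquad Q_2=(L^{2/(d+1)})_+ .$$ Here $L^{1/(d+1)}=\partial+\sum_{i<0}b_i\partial^i$ is the root of $L$ of this form in the algebra of formal pseudodifferential operators with smooth $2\pi$-periodic coefficients,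 $L^{2/(d+1)}$ is its square, and $(\cdot)_+$ is the purely differential part. -/

import Mathlib

open scoped ContDiff

noncomputable section

/-! ### Differential operators and formal pseudodifferential operators on the line -/

/-- A linear differential operator `∑_{j ≤ n} c_j(x) ∂^j` of order at most `n`, given by its
coefficient functions. -/
abbrev DiffOp (n : ℕ) : Type := Fin (n + 1) → ℝ → ℝ

/-- The action of a differential operator on a (vector-valued) function. -/
def DiffOp.act {n : ℕ} {E : Type*} [NormedAddCommGroup E] [NormedSpace ℝ E]
    (Q : DiffOp n) (f : ℝ → E) (x : ℝ) : E :=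
  ∑ j : Fin (n + 1), Q j x • iteratedDeriv (j : ℕ) f x

/-- A formal pseudodifferential operator `∑_{k ≥ 0} a_k(x) ∂^(N - k)`; here `N = order` and
`a_k = coeff k`. -/
@[ext]
structure PsiDO where
  order : ℤ
  coeff : ℕ → ℝ → ℝ

/-- Composition, determined by `∂^e ∘ b = ∑_{s ≥ 0} (e choose s) b^(s) ∂^(e - s)` for every
integer `e`, with the generalized binomial coefficient `e (e - 1) ⋯ (e - s + 1) / s!`. The
coefficient of `∂^(N + M - n)` collects the terms with `i + (s + l) = n`. -/
def PsiDO.mul (A B : PsiDO) : PsiDO where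
  order := A.order + B.order
  coeff n x := ∑ a ∈ Finset.HasAntidiagonal.antidiagonal n, ∑ b ∈ Finset.HasAntidiagonal.antidiagonal a.2,
    ((Ring.choose (A.order - (a.1 : ℤ)) b.1 : ℤ) : ℝ) * A.coeff a.1 x
      * iteratedDeriv b.1 (B.coeff b.2) x

/-- Powers of a formal pseudodifferential operator. -/
def PsiDO.npow (A : PsiDO) : ℕ → PsiDO
  | 0 => ⟨0, fun k _ => if k = 0 then 1 else 0⟩
  | m + 1 => (A.npow m).mul A

/-- The terms of `A` with exponents `0, …, n`. For `A` of order at most `n` this is the purely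
differential part `A₊`. -/
def PsiDO.diffPart (A : PsiDO) (n : ℕ) : DiffOp n :=
  fun j x => if ((j : ℕ) : ℤ) ≤ A.order then A.coeff (A.order - ((j : ℕ) : ℤ)).toNat x else 0

/-- A differential operator seen as a formal pseudodifferential operator. -/
def DiffOp.toPsiDO {n : ℕ} (Q : DiffOp n) : PsiDO where
  order := n
  coeff k x := if k ≤ n then Q ⟨n - k, by omega⟩ x else 0

/-- `L = ∂^(d+1) + u_{d-1} ∂^(d-1) + ⋯ + u_1 ∂ + u_0`. -/
def laxOp {d : ℕ} (u : Fin d → ℝ → ℝ) : DiffOp (d + 1) :=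
  fun j x => if h : (j : ℕ) < d then u ⟨j, h⟩ x else if (j : ℕ) = d + 1 then 1 else 0

/-- `R` is the root `L^(1/(d+1))` of `L`: it has the form `∂ + ∑_{i < 0} b_i ∂^i` with smooth
`2π`-periodic coefficients, and `R^(d+1) = L`. -/
structure IsLaxRoot {d : ℕ} (u : Fin d → ℝ → ℝ) (R : PsiDO) : Prop where
  order_eq : R.order = 1
  coeff_zero : R.coeff 0 = fun _ => 1
  coeff_one : R.coeff 1 = fun _ => 0
  smooth : ∀ k, ContDiff ℝ ∞ (R.coeff k)
  periodic : ∀ k, Function.Periodic (R.coeff k) (2 * Real.pi)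
  pow_eq : R.npow (d + 1) = (laxOp u).toPsiDO

/-- On the set `I` of times, `L = ∂^(d+1) + u_{d-1}(t, x) ∂^(d-1) + ⋯ + u_0(t, x)` has smooth
`2π`-periodic coefficients and solves the `(m, d+1)`-KdV equation `dL/dt = [Q_m, L]` with
`Q_m = (L^(m/(d+1)))₊`. The equality of differential operators is expressed by their action on all
smooth functions. -/
structure IsKdVSolution (m d : ℕ) (I : Set ℝ) (u : ℝ → Fin d → ℝ → ℝ) : Prop where
  smooth : ∀ t ∈ I, ∀ i, ContDiff ℝ ∞ (u t i)
  periodic : ∀ t ∈ I, ∀ i, Function.Periodic (u t i) (2 * Real.pi)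
  differentiable : ∀ t ∈ I, ∀ i x, DifferentiableAt ℝ (fun s => u s i x) t
  lax : ∀ t ∈ I, ∃ R : PsiDO, IsLaxRoot (u t) R ∧
    ∀ f : ℝ → ℝ, ContDiff ℝ ∞ f → ∀ x : ℝ,
      ∑ i : Fin d, deriv (fun s => u s i x) t * iteratedDeriv (i : ℕ) f x =
        ((R.npow m).diffPart m).act ((laxOp (u t)).act f) x
          - (laxOp (u t)).act (((R.npow m).diffPart m).act f) x

/-! ### Nondegenerate curves in projective space -/

/-- `det (Γ, Γ', …, Γ^(d))` at `x`. -/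
def curveWronskian {d : ℕ} (Γ : ℝ → Fin (d + 1) → ℝ) (x : ℝ) : ℝ :=
  Matrix.det (Matrix.of fun i j : Fin (d + 1) => iteratedDeriv (j : ℕ) Γ x i)

/-- `Γ` is a smooth lift of the curve `γ` in `ℝP^d` to `ℝ^(d+1)`, normalized by
`det (Γ, Γ', …, Γ^(d)) ≡ 1`. (In particular `γ` is smooth and nondegenerate.) -/
structure IsNormalizedLift {d : ℕ} (γ : ℝ → Projectivization ℝ (Fin (d + 1) → ℝ))
    (Γ : ℝ → Fin (d + 1) → ℝ) : Prop where
  smooth : ContDiff ℝ ∞ Γ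
  lift : ∀ x, ∃ h : Γ x ≠ 0, Projectivization.mk ℝ (Γ x) h = γ x
  wronskian : ∀ x, curveWronskian Γ x = 1

/-- `γ(x + 2π) = M · γ(x)` for all `x` and some projective transformation `M`. -/
def HasMonodromy {d : ℕ} (γ : ℝ → Projectivization ℝ (Fin (d + 1) → ℝ)) : Prop :=
  ∃ M : (Fin (d + 1) → ℝ) ≃ₗ[ℝ] (Fin (d + 1) → ℝ),
    ∀ x, γ (x + 2 * Real.pi) = Projectivization.map M.toLinearMap M.injective (γ x)

/-! ### The χ-pentagram map -/

/-- The parameters `χ = {{p_{1,0}, …, p_{1,q_1}}, …, {p_{r,0}, …, p_{r,q_r}}}` of a χ-pentagram map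
in `ℝP^d`. -/
structure ChiConfig (d : ℕ) where
  r : ℕ
  q : Fin r → ℕ
  p : (i : Fin r) → Fin (q i + 1) → ℝ
  one_le_q : ∀ i, 1 ≤ q i
  q_le : ∀ i, q i ≤ d
  p_injective : ∀ i, Function.Injective (p i)
  codim_sum : ∑ i, (d - q i) = d

/-- The subspace `P_ε^i(x)` spanned by `γ(x + p_{i,0} ε), …, γ(x + p_{i,q_i} ε)`, as a linear
subspace of `ℝ^(d+1)`. -/
def ChiConfig.plane {d : ℕ} (χ : ChiConfig d) (ε : ℝ)
    (γ : ℝ → Projectivization ℝ (Fin (d + 1) → ℝ)) (i : Fin χ.r) (x : ℝ) :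
    Submodule ℝ (Fin (d + 1) → ℝ) :=
  ⨆ j : Fin (χ.q i + 1), (γ (x + χ.p i j * ε)).submodule

/-- `η = T_ε^χ(γ)`: for every `x` the intersection of the subspaces `P_ε^i(x)` is exactly the point
`η(x)`. -/
def ChiConfig.IsImage {d : ℕ} (χ : ChiConfig d) (ε : ℝ)
    (γ η : ℝ → Projectivization ℝ (Fin (d + 1) → ℝ)) : Prop :=
  ∀ x, (η x).submodule = ⨅ i : Fin χ.r, χ.plane ε γ i x

/-- The matrix `M_0` of the leading-order coplanarity conditions. Its rows are indexed by the
pairs `(i, j)` with `1 ≤ j ≤ d - q_i` and its columns by `1 ≤ l ≤ d` (in the code `j` and `l` are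
shifted by one). The entry is the coefficient of `e_0 ∧ ⋯ ∧ e_{q_i} ∧ e_{q_i + j}` in
`e_l ∧ v(p_{i,0}) ∧ ⋯ ∧ v(p_{i,q_i})`, where `v(p) = ∑_β p^β / β! e_β`, that is, the minor on the
rows `0, …, q_i, q_i + j` of the matrix with these vectors as columns. -/
def ChiConfig.leadingMatrix {d : ℕ} (χ : ChiConfig d) :
    Matrix (Σ i : Fin χ.r, Fin (d - χ.q i)) (Fin d) ℝ :=
  Matrix.of fun ij l =>
    Matrix.det (Matrix.of fun a b : Fin (χ.q ij.1 + 1 + 1) =>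
      let row : ℕ := if (a : ℕ) ≤ χ.q ij.1 then (a : ℕ) else χ.q ij.1 + ((ij.2 : ℕ) + 1)
      (Fin.cons (if row = (l : ℕ) + 1 then 1 else 0)
        (fun k => χ.p ij.1 k ^ row / (Nat.factorial row : ℝ)) : Fin (χ.q ij.1 + 1 + 1) → ℝ) b)

/-- The configuration is nondegenerate: the matrix `M_0`, which has as many rows as columns, is
invertible. -/
def ChiConfig.Nondegenerate {d : ℕ} (χ : ChiConfig d) : Prop :=
  Function.Bijective χ.leadingMatrix.mulVec

/-- For all small `ε > 0` the curve `T_ε^χ(γ)` is defined and has a normalized lift `Γ_ε`, and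
`Γ_ε = Γ + ε G₁ Γ + ε² G₂ Γ + O(ε³)` as `ε → 0`, uniformly in `x` on compact sets. -/
def ChiConfig.HasExpansion {d : ℕ} (χ : ChiConfig d)
    (γ : ℝ → Projectivization ℝ (Fin (d + 1) → ℝ)) (Γ : ℝ → Fin (d + 1) → ℝ)
    (G₁ G₂ : DiffOp d) : Prop :=
  ∃ ε₀ : ℝ, 0 < ε₀ ∧ ∃ Γε : ℝ → ℝ → Fin (d + 1) → ℝ,
    (∀ ε ∈ Set.Ioo 0 ε₀, ∃ η : ℝ → Projectivization ℝ (Fin (d + 1) → ℝ),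
      χ.IsImage ε γ η ∧ IsNormalizedLift η (Γε ε)) ∧
    ∀ K : Set ℝ, IsCompact K → ∃ C : ℝ, ∀ ε ∈ Set.Ioo 0 ε₀, ∀ x ∈ K,
      ‖Γε ε x - (Γ x + ε • G₁.act Γ x + ε ^ 2 • G₂.act Γ x)‖ ≤ C * ε ^ 3

/-- The configuration is centralized: `G₁ = 0`, that is, the expansion always has the form
`Γ_ε = Γ + ε² G₂ Γ + O(ε³)`. -/
def ChiConfig.Centralized {d : ℕ} (χ : ChiConfig d) : Prop :=
  ∀ (γ : ℝ → Projectivization ℝ (Fin (d + 1) → ℝ)) (Γ : ℝ → Fin (d + 1) → ℝ),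
    IsNormalizedLift γ Γ → HasMonodromy γ →
      ∃ G₂ : DiffOp d, χ.HasExpansion γ Γ (0 : DiffOp d) G₂

/-- The operator `α₁₁ ∂`. -/
def opG₁ (d : ℕ) (α₁₁ : ℝ) : DiffOp d :=
  fun j _ => if (j : ℕ) = 1 then α₁₁ else 0

/-- The operator `α₂₂ (∂² + 2/(d+1) w) - α₁₁²/(d+1) w`, where `w` is a function of `x`. -/
def opG₂ (d : ℕ) (α₁₁ α₂₂ : ℝ) (w : ℝ → ℝ) : DiffOp d :=
  fun j x =>
    if (j : ℕ) = 2 then α₂₂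
    else if (j : ℕ) = 0 then α₂₂ * (2 / ((d : ℝ) + 1) * w x) - α₁₁ ^ 2 / ((d : ℝ) + 1) * w x
    else 0

end

/-! ### Calculus preliminaries: smooth Taylor remainders -/

noncomputable section

/-! Work in the moving frame `(Γ, Γ', …, Γ^(d))` at `x` and divide the coordinate of index `β` by
`ε^β`. By Taylor's formula `Γ(x + pε)` then has coordinates `p^β/β! + O(ε²)`
(`exists_rescaled_coord`). A term linear in `ε` could come only from `Γ^(d+1)` in the coordinate `β
= d`, and it vanishes because `L` has no `∂^d` term. Hence modulo `ε²` the coplanarity conditions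
form a constant linear system depending only on `χ`, invertible by nondegeneracy. Cramer's rule
(`ChiConfig.iInf_plane_eq`) gives a representative `Γ + εaΓ' + ε²bΓ'' + ε³R` of the intersection
point, with `a`, `b` constants of `χ` and `R` smooth in `(ε, x)`; these are `α₁₁ = a` and `α₂₂ = b`.

The potential enters only through normalization. The Wronskian of the representative is `det(1 +
εaN₁ + ε²bN₂ + ε³Z)`, where `N_k` sends `Γ^(j)` to `Γ^(j+k)`. Since `tr N₁ = 0` and `tr N₁² = tr N₂
= -2u_{d-1}`, it equals `1 + ε²(a² - 2b)u_{d-1} + O(ε³)` (`exists_curveWronskian_expansion`).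
Multiplying the curve by the power `-1/(d+1)` of this Wronskian produces the stated `G₂`
(`ChiConfig.hasExpansion_of_perturbedCurve`). Monodromy makes the relevant functions periodic in
`x`, so one bound on `ε` serves all `x`.

A normalized lift is unique up to a constant sign, so a centralized configuration has `a = 0`
(`ChiConfig.HasExpansion.eq_zero_of_zero`), and `G₂ ≠ 0` then forces `b ≠ 0`. The root of `L` is
built coefficient by coefficient, and the differential part of its square is `Q₂ = ∂² +
2u_{d-1}/(d+1)` (`exists_isLaxRoot`), so the flow is `Γ_t = bQ₂Γ`. Differentiating `LΓ = 0` in `t`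
shows that `L_t` and `b[Q₂, L]` agree on the components of `Γ`. Both have order at most `d`, and the
`d + 1` components realize every `d`-jet at a point, so the operators are equal
(`lax_equation_of_flow`). -/

theorem sub_one_lt_of_two_le {d : ℕ} (hd : 2 ≤ d) : d - 1 < d := by omega

theorem hasFDerivAt_integral_param {H E : Type} [NormedAddCommGroup H] [NormedSpace ℝ H]
    [ProperSpace H] [NormedAddCommGroup E] [NormedSpace ℝ E]
    {f : H × ℝ → E} (hf : ContDiff ℝ 1 f) (x : H) :
    HasFDerivAt (fun x => ∫ t in (0 : ℝ)..1, f (x, t))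
      (∫ t in (0 : ℝ)..1, (fderiv ℝ f (x, t)).comp (ContinuousLinearMap.inl ℝ H ℝ)) x := by
  have hc : Continuous fun z : H × ℝ => (fderiv ℝ f z).comp (ContinuousLinearMap.inl ℝ H ℝ) :=
    (hf.continuous_fderiv (by norm_num)).clm_comp continuous_const
  obtain ⟨C, hC⟩ := ((isCompact_closedBall x 1).prod (isCompact_Icc (a := (0 : ℝ)) (b := 1))).exists_bound_of_continuousOn
    hc.continuousOn
  refine intervalIntegral.hasFDerivAt_integral_of_dominated_of_fderiv_le
    (F' := fun y t => (fderiv ℝ f (y, t)).comp (ContinuousLinearMap.inl ℝ H ℝ))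
    (bound := fun _ => C) (Metric.closedBall_mem_nhds x one_pos) ?_ ?_ ?_ ?_ ?_ ?_
  · refine Filter.Eventually.of_forall fun y => ?_
    exact (hf.continuous.comp (by fun_prop)).aestronglyMeasurable
  · exact (hf.continuous.comp (by fun_prop)).intervalIntegrable _ _
  · exact (hc.comp (by fun_prop : Continuous fun t : ℝ => (x, t))).aestronglyMeasurable
  · refine Filter.Eventually.of_forall fun t ht y hy => hC (y, t) ⟨hy, ?_⟩
    rw [Set.uIoc_of_le zero_le_one] at ht
    exact ⟨ht.1.le, ht.2⟩
  · exact intervalIntegrable_const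
  · refine Filter.Eventually.of_forall fun t _ y _ => ?_
    exact ((hf.differentiable (by norm_num) (y, t)).hasFDerivAt).comp y
      (hasFDerivAt_prodMk_left y t)

/-- Differentiation under the integral reproduces an integral of the same kind, with values in a
space of continuous linear maps. The target space therefore has to vary in the induction. -/
theorem contDiff_integral_param_nat {H : Type} [NormedAddCommGroup H] [NormedSpace ℝ H]
    [ProperSpace H] (n : ℕ) :
    ∀ {E : Type} [NormedAddCommGroup E] [NormedSpace ℝ E] {f : H × ℝ → E}, ContDiff ℝ ∞ f →
      ContDiff ℝ n (fun x => ∫ t in (0 : ℝ)..1, f (x, t)) := by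
  induction n with
  | zero =>
    intro E _ _ f hf
    refine contDiff_zero.2 ?_
    exact intervalIntegral.continuous_parametric_intervalIntegral_of_continuous' (f := fun x t => f (x, t))
      hf.continuous 0 1
  | succ n ih =>
    intro E _ _ f hf
    have h := fun x => hasFDerivAt_integral_param (hf.of_le (by exact_mod_cast le_top)) x
    refine contDiff_succ_iff_hasFDerivAt.2 ⟨_, ?_, h⟩
    refine ih (f := fun z : H × ℝ => (fderiv ℝ f z).comp (ContinuousLinearMap.inl ℝ H ℝ)) ?_
    exact (hf.fderiv_right (by simp)).clm_comp contDiff_const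

theorem contDiff_integral_param {H E : Type} [NormedAddCommGroup H] [NormedSpace ℝ H]
    [ProperSpace H] [NormedAddCommGroup E] [NormedSpace ℝ E] {f : H × ℝ → E}
    (hf : ContDiff ℝ ∞ f) : ContDiff ℝ ∞ (fun x => ∫ t in (0 : ℝ)..1, f (x, t)) :=
  contDiff_infty.2 fun n => contDiff_integral_param_nat n hf

/-- Taylor's formula with a remainder depending smoothly on base point and increment. -/
theorem exists_smooth_taylor_remainder (n : ℕ) {f : ℝ → ℝ} (hf : ContDiff ℝ ∞ f) :
    ∃ ρ : ℝ × ℝ → ℝ, ContDiff ℝ ∞ ρ ∧ ∀ s x, f (x + s) =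
      ∑ k ∈ Finset.range (n + 1), s ^ k / (k.factorial : ℝ) * iteratedDeriv k f x
        + s ^ (n + 1) * ρ (s, x) := by
  -- The fundamental theorem of calculus along the segment from `x` to `x + s`.
  have key : ∀ {f : ℝ → ℝ}, ContDiff ℝ ∞ f → ∀ s x,
      f (x + s) = f x + s * ∫ t in (0 : ℝ)..1, deriv f (x + t * s) := by
    intro f hf s x
    have hd : Continuous (deriv f) := hf.continuous_deriv (by norm_num)
    have h := intervalIntegral.integral_eq_sub_of_hasDerivAt
      (f := fun t => f (x + t * s)) (f' := fun t => deriv f (x + t * s) * s) (a := 0) (b := 1)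
      (fun t _ => by
        have h1 : HasDerivAt (fun t : ℝ => x + t * s) s t := by
          simpa using ((hasDerivAt_id t).mul_const s).const_add x
        exact ((hf.differentiable (by norm_num) _).hasDerivAt).comp t h1)
      ((by fun_prop : Continuous fun t => deriv f (x + t * s) * s).intervalIntegrable _ _)
    rw [intervalIntegral.integral_mul_const] at h
    simp only [one_mul, zero_mul, add_zero] at h
    linarith
  induction n generalizing f with
  | zero =>
    refine ⟨fun z => ∫ t in (0 : ℝ)..1, deriv f (z.2 + t * z.1), ?_, fun s x => ?_⟩
    · refine contDiff_integral_param (f := fun z : (ℝ × ℝ) × ℝ => deriv f (z.1.2 + z.2 * z.1.1)) ?_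
      have : ContDiff ℝ ∞ (deriv f) := hf.deriv' 
      fun_prop
    · simpa using key hf s x
  | succ n ih =>
    have hd : ContDiff ℝ ∞ (deriv f) := hf.deriv'
    obtain ⟨ρ, hρ, h⟩ := ih hd
    -- Inserting the expansion of `f'` at `x + ts` into `key` leaves the remainder `(ts)^(n+1) ρ(ts,
    -- x)`, which is then integrated over `t`.
    refine ⟨fun z => ∫ t in (0 : ℝ)..1, t ^ (n + 1) * ρ (t * z.1, z.2), ?_, fun s x => ?_⟩
    · refine contDiff_integral_param
        (f := fun z : (ℝ × ℝ) × ℝ => z.2 ^ (n + 1) * ρ (z.2 * z.1.1, z.1.2)) ?_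
      fun_prop
    · rw [key hf s x]
      have hρc := hρ.continuous
      have : ∀ t, deriv f (x + t * s) =
          ∑ k ∈ Finset.range (n + 1), t ^ k * (s ^ k / (k.factorial : ℝ) * iteratedDeriv (k + 1) f x)
          + s ^ (n + 1) * (t ^ (n + 1) * ρ (t * s, x)) := by
        intro t
        rw [h]
        simp only [iteratedDeriv_succ']
        congr 1
        · refine Finset.sum_congr rfl fun k _ => by rw [mul_pow]; ring
        · ring
      simp only [this]
      rw [intervalIntegral.integral_add, intervalIntegral.integral_finsetSum,
        intervalIntegral.integral_const_mul, Finset.sum_range_succ' _ (n + 1)]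
      · simp only [intervalIntegral.integral_mul_const, integral_pow]
        rw [mul_add, Finset.mul_sum]
        have : ∀ k ∈ Finset.range (n + 1), s * (((1 : ℝ) ^ (k + 1) - 0 ^ (k + 1)) / ((k : ℝ) + 1) *
            (s ^ k / (k.factorial : ℝ) * iteratedDeriv (k + 1) f x)) =
            s ^ (k + 1) / ((k + 1).factorial : ℝ) * iteratedDeriv (k + 1) f x := by
          intro k _
          rw [Nat.factorial_succ]
          push_cast
          simp only [one_pow, zero_pow (Nat.succ_ne_zero k), sub_zero]
          field_simp
          ring
        rw [Finset.sum_congr rfl this]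
        simp
        ring
      · intro k _
        exact (by fun_prop : Continuous _).intervalIntegrable _ _
      · exact (by fun_prop : Continuous _).intervalIntegrable _ _
      · exact (by fun_prop : Continuous _).intervalIntegrable _ _

/-! ### Mixed partial derivatives of functions of time and position -/

section partials

variable {E : Type*} [NormedAddCommGroup E] [NormedSpace ℝ E]

theorem hasDerivAt_snd_of_contDiffOn {I : Set ℝ} (hI : IsOpen I) {F : ℝ → ℝ → E}
    (hF : ContDiffOn ℝ ∞ (fun z : ℝ × ℝ => F z.1 z.2) (I ×ˢ Set.univ)) {t : ℝ} (ht : t ∈ I) (x : ℝ) :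
    HasDerivAt (F t) (fderiv ℝ (fun z : ℝ × ℝ => F z.1 z.2) (t, x) (0, 1)) x := by
  have h := ((hF.contDiffAt ((hI.prod isOpen_univ).mem_nhds (x := (t, x)) ⟨ht, trivial⟩)).differentiableAt
    (by norm_num)).hasFDerivAt
  have h2 : HasDerivAt (fun y : ℝ => (t, y)) ((0 : ℝ), (1 : ℝ)) x :=
    (hasDerivAt_const x t).prodMk (hasDerivAt_id x)
  exact h.comp_hasDerivAt x h2

theorem hasDerivAt_fst_of_contDiffOn {I : Set ℝ} (hI : IsOpen I) {F : ℝ → ℝ → E}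
    (hF : ContDiffOn ℝ ∞ (fun z : ℝ × ℝ => F z.1 z.2) (I ×ˢ Set.univ)) {t : ℝ} (ht : t ∈ I) (x : ℝ) :
    HasDerivAt (fun s => F s x) (fderiv ℝ (fun z : ℝ × ℝ => F z.1 z.2) (t, x) (1, 0)) t := by
  have h := ((hF.contDiffAt ((hI.prod isOpen_univ).mem_nhds (x := (t, x)) ⟨ht, trivial⟩)).differentiableAt
    (by norm_num)).hasFDerivAt
  have h2 : HasDerivAt (fun y : ℝ => (y, x)) ((1 : ℝ), (0 : ℝ)) t :=
    (hasDerivAt_id t).prodMk (hasDerivAt_const t x)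
  exact h.comp_hasDerivAt t h2

theorem contDiffOn_deriv_snd {I : Set ℝ} (hI : IsOpen I) {F : ℝ → ℝ → E}
    (hF : ContDiffOn ℝ ∞ (fun z : ℝ × ℝ => F z.1 z.2) (I ×ˢ Set.univ)) :
    ContDiffOn ℝ ∞ (fun z : ℝ × ℝ => deriv (F z.1) z.2) (I ×ˢ Set.univ) := by
  have h : ContDiffOn ℝ ∞ (fun z : ℝ × ℝ => fderiv ℝ (fun z : ℝ × ℝ => F z.1 z.2) z (0, 1))
      (I ×ˢ Set.univ) :=
    (hF.fderiv_of_isOpen (hI.prod isOpen_univ) (by simp)).clm_apply contDiffOn_const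
  exact h.congr fun z hz => (hasDerivAt_snd_of_contDiffOn hI hF hz.1 z.2).deriv

theorem contDiffOn_iteratedDeriv_snd {I : Set ℝ} (hI : IsOpen I) {F : ℝ → ℝ → E}
    (hF : ContDiffOn ℝ ∞ (fun z : ℝ × ℝ => F z.1 z.2) (I ×ˢ Set.univ)) (n : ℕ) :
    ContDiffOn ℝ ∞ (fun z : ℝ × ℝ => iteratedDeriv n (F z.1) z.2) (I ×ˢ Set.univ) := by
  induction n with
  | zero => simpa using hF
  | succ n ih =>
    simp only [iteratedDeriv_succ]
    exact contDiffOn_deriv_snd hI (F := fun t => iteratedDeriv n (F t)) ih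

theorem contDiff_iteratedDeriv_snd {F : ℝ → ℝ → E}
    (hF : ContDiff ℝ ∞ (fun z : ℝ × ℝ => F z.1 z.2)) (n : ℕ) :
    ContDiff ℝ ∞ (fun z : ℝ × ℝ => iteratedDeriv n (F z.1) z.2) := by
  have := contDiffOn_iteratedDeriv_snd isOpen_univ (F := F) hF.contDiffOn n
  rwa [Set.univ_prod_univ, contDiffOn_univ] at this

/-- Both sides are values of the second Fréchet derivative on the two coordinate directions, and
that derivative is symmetric. -/
theorem deriv_fst_deriv_snd_comm {I : Set ℝ} (hI : IsOpen I) {F : ℝ → ℝ → E}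
    (hF : ContDiffOn ℝ ∞ (fun z : ℝ × ℝ => F z.1 z.2) (I ×ˢ Set.univ)) {t : ℝ} (ht : t ∈ I) (x : ℝ) :
    deriv (fun s => deriv (F s) x) t = deriv (fun y => deriv (fun s => F s y) t) x := by
  set G : ℝ × ℝ → E := fun z => F z.1 z.2 with hG
  have hO := hI.prod (isOpen_univ (X := ℝ))
  have hmem : (t, x) ∈ I ×ˢ (Set.univ : Set ℝ) := ⟨ht, trivial⟩
  have hGx : ContDiffAt ℝ ∞ G (t, x) := hF.contDiffAt (hO.mem_nhds hmem)
  have hsymm : IsSymmSndFDerivAt ℝ G (t, x) := hGx.isSymmSndFDerivAt (by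
    rw [minSmoothness_of_isRCLikeNormedField]; exact WithTop.coe_le_coe.2 le_top)
  have hf2 : DifferentiableAt ℝ (fderiv ℝ G) (t, x) :=
    (hGx.fderiv_right (m := 1) (by exact WithTop.coe_le_coe.2 le_top)).differentiableAt (by norm_num)
  have e1 : (fun s => deriv (F s) x) =ᶠ[nhds t] fun s => fderiv ℝ G (s, x) (0, 1) := by
    filter_upwards [hI.mem_nhds ht] with s hs
    exact (hasDerivAt_snd_of_contDiffOn hI hF hs x).deriv
  have e2 : (fun y => deriv (fun s => F s y) t) = fun y => fderiv ℝ G (t, y) (1, 0) := by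
    funext y
    exact (hasDerivAt_fst_of_contDiffOn hI hF ht y).deriv
  have h1 : HasDerivAt (fun s => fderiv ℝ G (s, x) (0, 1))
      (fderiv ℝ (fderiv ℝ G) (t, x) (1, 0) (0, 1)) t := by
    have h2 : HasDerivAt (fun y : ℝ => (y, x)) ((1 : ℝ), (0 : ℝ)) t :=
      (hasDerivAt_id t).prodMk (hasDerivAt_const t x)
    exact (ContinuousLinearMap.apply ℝ E ((0 : ℝ), (1 : ℝ))).hasFDerivAt.comp_hasDerivAt t
      (hf2.hasFDerivAt.comp_hasDerivAt t h2)
  have h2 : HasDerivAt (fun y => fderiv ℝ G (t, y) (1, 0))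
      (fderiv ℝ (fderiv ℝ G) (t, x) (0, 1) (1, 0)) x := by
    have h2 : HasDerivAt (fun y : ℝ => (t, y)) ((0 : ℝ), (1 : ℝ)) x :=
      (hasDerivAt_const x t).prodMk (hasDerivAt_id x)
    exact (ContinuousLinearMap.apply ℝ E ((1 : ℝ), (0 : ℝ))).hasFDerivAt.comp_hasDerivAt x
      (hf2.hasFDerivAt.comp_hasDerivAt x h2)
  rw [e1.deriv_eq, e2, h1.deriv, h2.deriv, hsymm.eq]

/-- This turns an evolution equation for the curve into one for all its jets. The induction applies
the case `n` to the `x`-derivative of `F` and then interchanges one pair of derivatives. -/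
theorem hasDerivAt_iteratedDeriv_fst {I : Set ℝ} (hI : IsOpen I) {F : ℝ → ℝ → E}
    (hF : ContDiffOn ℝ ∞ (fun z : ℝ × ℝ => F z.1 z.2) (I ×ˢ Set.univ)) {t : ℝ} (ht : t ∈ I) (x : ℝ)
    (n : ℕ) :
    HasDerivAt (fun s => iteratedDeriv n (F s) x)
      (iteratedDeriv n (fun y => deriv (fun s => F s y) t) x) t := by
  induction n generalizing F with
  | zero =>
    have := hasDerivAt_fst_of_contDiffOn hI hF ht x
    simpa [this.deriv] using this
  | succ n ih =>
    have h := ih (F := fun s y => deriv (F s) y) (contDiffOn_deriv_snd hI hF)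
    simp only [iteratedDeriv_succ']
    convert h using 2
    funext y
    exact (deriv_fst_deriv_snd_comm hI hF ht y).symm

end partials

/-- A continuous function that is periodic in the second variable stays, for small values of the
first variable, in any open set containing its values on the zero slice. -/
theorem exists_forall_mem_of_periodic {X : Type*} [TopologicalSpace X] {g : ℝ × ℝ → X}
    (hg : Continuous g) {T : ℝ} (hT : 0 < T)
    (hper : ∀ ε x, g (ε, x + T) = g (ε, x)) {U : Set X} (hU : IsOpen U)
    (h0 : ∀ x, g (0, x) ∈ U) : ∃ δ > 0, ∀ ε, |ε| < δ → ∀ x, g (ε, x) ∈ U := by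
  -- The tube lemma around `{0} × [0, T]` gives a uniform bound over one period, and periodicity
  -- extends it to the whole line.
  obtain ⟨V, W, hV, hW, hVs, hWs, hVW⟩ := generalized_tube_lemma (isCompact_singleton (x := (0 : ℝ)))
    (isCompact_Icc (a := 0) (b := T)) (hU.preimage hg) (by
      rintro ⟨e, x⟩ ⟨he, hx⟩
      obtain rfl : e = 0 := he
      exact h0 x)
  obtain ⟨δ, hδ, hball⟩ := Metric.isOpen_iff.1 hV 0 (hVs rfl)
  refine ⟨δ, hδ, fun ε hε x => ?_⟩
  have hp : Function.Periodic (fun x => g (ε, x)) T := hper ε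
  obtain ⟨y, hy, hxy⟩ := hp.exists_mem_Ico₀ hT x
  change g (ε, x) = g (ε, y) at hxy
  rw [hxy]
  exact hVW ⟨hball (by simpa using hε), hWs ⟨hy.1, hy.2.le⟩⟩

end

/-! ### Determinant expansions over commutative rings -/

noncomputable section

section det

variable {R : Type*} [CommRing R] {n : Type*} [Fintype n] [DecidableEq n]

/-- The determinant commutes with reduction modulo `I`. -/
theorem Matrix.det_sub_det_mem {I : Ideal R} {A B : Matrix n n R} (h : ∀ i j, A i j - B i j ∈ I) :
    A.det - B.det ∈ I := by
  rw [← Ideal.Quotient.eq, RingHom.map_det, RingHom.map_det]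
  congr 1
  ext i j
  exact Ideal.Quotient.eq.2 (h i j)

open Polynomial in
/-- Second coefficient of `det (1 + X M)`. -/
theorem Matrix.two_mul_coeff_two_det_one_add_X_smul (M : Matrix n n R) :
    2 * (det (1 + (X : R[X]) • M.map C)).coeff 2 = M.trace ^ 2 - (M * M).trace := by
  set p := det (1 + (X : R[X]) • M.map C) with hp
  -- The identity behind the proof is `p(X) p(-X) = det(1 - X² M²)`, whose coefficients of `X²` are
  -- compared.
  have hcomp : p.comp (-X) = det (1 - (X : R[X]) • M.map C) := by
    rw [hp, ← Polynomial.coe_compRingHom_apply, RingHom.map_det]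
    congr 1
    ext1 i j
    rcases eq_or_ne i j with rfl | h
    · simp [sub_eq_add_neg]
    · simp [h]
  have hsq : det (1 + (X : R[X]) • (-(M * M)).map C) =
      1 + (-(M * M)).trace • X + (det (1 + (X : R[X]) • (-(M * M)).map C)).divX.divX * X ^ 2 :=
    Matrix.det_one_add_X_smul _
  set s := det (1 + (X : R[X]) • (-(M * M)).map C) with hs
  have hscomp : s.comp (X ^ 2) = p * p.comp (-X) := by
    rw [hcomp, hp, ← Matrix.det_mul, hs, ← Polynomial.coe_compRingHom_apply, RingHom.map_det]
    congr 1
    have : (1 + (X : R[X]) • M.map C) * (1 - (X : R[X]) • M.map C)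
        = 1 - (X : R[X]) ^ 2 • (M * M).map C := by
      simp only [Matrix.map_mul, mul_sub, add_mul, mul_one, one_mul, Matrix.smul_mul,
        Matrix.mul_smul, smul_smul, pow_two]
      abel
    rw [this]
    ext1 i j
    rcases eq_or_ne i j with rfl | h
    · simp [-Matrix.map_mul]
      ring
    · simp [h, -Matrix.map_mul]
  have h0 : p.coeff 0 = 1 := by
    rw [hp, Matrix.det_one_add_X_smul]
    simp [pow_two, ← mul_assoc]
  have h1 : p.coeff 1 = M.trace := Matrix.coeff_det_one_add_X_smul_one M
  have c2 := congrArg (fun f : R[X] => f.coeff 2) hscomp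
  have l2 : (s.comp (X ^ 2)).coeff 2 = -(M * M).trace := by
    rw [hsq]
    simp [← pow_mul, coeff_X_pow, coeff_one, coeff_mul_X_pow']
  have hneg : ∀ k, (p.comp (-X)).coeff k = (-1) ^ k * p.coeff k := by
    intro k
    rw [show (-X : R[X]) = C (-1) * X by simp, Polynomial.comp_C_mul_X_coeff, mul_comm]
  have r2 : (p * p.comp (-X)).coeff 2 = 2 * p.coeff 2 - M.trace ^ 2 := by
    rw [coeff_mul, Finset.Nat.sum_antidiagonal_eq_sum_range_succ_mk]
    simp only [Finset.sum_range_succ, Finset.sum_range_zero, hneg, h0, h1]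
    norm_num [h0, h1]
    ring
  simp only [l2, r2] at c2
  linear_combination -c2

open Polynomial in
/-- Expansion of `det (1 + e X + e² Y + e³ Z)` modulo `e³`. -/
theorem Matrix.exists_det_expansion (e : R) (X Y Z : Matrix n n R) :
    ∃ m r : R, 2 * m = X.trace ^ 2 - (X * X).trace ∧
      (1 + e • X + e ^ 2 • Y + e ^ 3 • Z).det
        = 1 + e * X.trace + e ^ 2 * (Y.trace + m) + e ^ 3 * r := by
  -- Modulo `e³` the matrix factors as `(1 + eX)(1 + e²Y)`, the cross term being `e³XY`. Each factor
  -- then depends on a single matrix.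
  have h1 : (1 + e • X + e ^ 2 • Y + e ^ 3 • Z).det - ((1 + e • X) * (1 + e ^ 2 • Y)).det
      ∈ Ideal.span {e ^ 3} := by
    refine Matrix.det_sub_det_mem fun i j => Ideal.mem_span_singleton'.2 ⟨Z i j - (X * Y) i j, ?_⟩
    simp only [mul_add, add_mul, one_mul, mul_one, Matrix.smul_mul, Matrix.mul_smul,
      Matrix.add_apply, Matrix.smul_apply, smul_eq_mul]
    ring
  obtain ⟨r, hr⟩ := Ideal.mem_span_singleton'.1 h1
  rw [Matrix.det_mul] at hr
  have hX : ∃ r', (1 + e • X).det = 1 + e * X.trace +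
      e ^ 2 * (det (1 + (Polynomial.X : R[X]) • X.map C)).coeff 2 + e ^ 3 * r' := by
    refine ⟨(det (1 + (Polynomial.X : R[X]) • X.map C)).divX.divX.divX.eval e, ?_⟩
    rw [Matrix.det_one_add_smul]
    set q := (det (1 + (Polynomial.X : R[X]) • X.map C)).divX.divX with hq
    have : q.eval e = e * q.divX.eval e + (det (1 + (Polynomial.X : R[X]) • X.map C)).coeff 2 := by
      conv_lhs => rw [← Polynomial.divX_mul_X_add q]
      simp only [eval_add, eval_mul, eval_X, eval_C]
      rw [hq, Polynomial.coeff_divX, Polynomial.coeff_divX]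
      ring
    rw [this]
    ring
  obtain ⟨r', hr'⟩ := hX
  have hY := Matrix.det_one_add_smul (e ^ 2) Y
  set q := (det (1 + (Polynomial.X : R[X]) • X.map C)).coeff 2 with hq
  set t := (det (1 + (Polynomial.X : R[X]) • Y.map C)).divX.divX.eval (e ^ 2)
  refine ⟨q, r + r' + X.trace * Y.trace + e * q * Y.trace + e ^ 2 * r' * Y.trace
    + e * t * (1 + e • X).det, X.two_mul_coeff_two_det_one_add_X_smul, ?_⟩
  rw [hY, hr'] at hr
  rw [hr']
  linear_combination -hr

end det

/-! ### Membership in a span through minors -/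

/-- The row numbers `0, …, q, q + j + 1`. -/
def minorRow (q j : ℕ) (a : ℕ) : ℕ := if a ≤ q then a else q + (j + 1)

/-- The matrix with columns `z, V 0, …, V q` and rows `0, …, q, q + j + 1`. -/
def borderMatrix {R : Type*} (q j : ℕ) (z : ℕ → R) (V : Fin (q + 1) → ℕ → R) :
    Matrix (Fin (q + 1 + 1)) (Fin (q + 1 + 1)) R :=
  Matrix.of fun a b => (Fin.cons (z (minorRow q j a)) (fun k => V k (minorRow q j a)) :
    Fin (q + 1 + 1) → R) b

section minors

variable {R : Type*} [CommRing R]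

/-- Laplace expansion along the first column: the cofactors do not involve `z`. -/
theorem det_borderMatrix_sum {ι : Type*} (s : Finset ι) (q j : ℕ) (c : ι → R) (z : ι → ℕ → R)
    (V : Fin (q + 1) → ℕ → R) :
    (borderMatrix q j (fun β => ∑ l ∈ s, c l * z l β) V).det
      = ∑ l ∈ s, c l * (borderMatrix q j (z l) V).det := by
  have key : ∀ z : ℕ → R, (borderMatrix q j z V).det = ∑ a : Fin (q + 1 + 1),
      (-1) ^ (a : ℕ) * z (minorRow q j a) *
        ((borderMatrix q j 0 V).submatrix a.succAbove Fin.succ).det := by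
    intro z
    rw [Matrix.det_succ_column_zero]
    refine Finset.sum_congr rfl fun a _ => ?_
    congr 2
  simp only [key, Finset.mul_sum, Finset.sum_mul]
  rw [Finset.sum_comm]
  refine Finset.sum_congr rfl fun l _ => Finset.sum_congr rfl fun a _ => ?_
  ring

theorem det_borderMatrix_congr {q j d : ℕ} (hj : j < d - q) {z z' : ℕ → R}
    (V : Fin (q + 1) → ℕ → R) (h : ∀ β ≤ d, z β = z' β) :
    (borderMatrix q j z V).det = (borderMatrix q j z' V).det := by
  congr 1
  ext1 a b
  have : minorRow q j a ≤ d := by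
    unfold minorRow
    split_ifs <;> omega
  simp only [borderMatrix, Matrix.of_apply, h _ this]

theorem borderMatrix_map {R' : Type*} [CommRing R'] (f : R →+* R') (q j : ℕ) (z : ℕ → R)
    (V : Fin (q + 1) → ℕ → R) :
    f (borderMatrix q j z V).det
      = (borderMatrix q j (fun β => f (z β)) (fun k β => f (V k β))).det := by
  rw [RingHom.map_det]
  congr 1
  ext1 a b
  refine Fin.cases ?_ (fun k => ?_) b <;> simp [borderMatrix]

end minors

/-- If the top minor of `V` is nonzero, then `z` is a combination of the `V k` in the rows
`0, …, d` if and only if all bordered minors vanish. -/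
theorem exists_combination_iff_minors {K : Type*} [Field K] {d q : ℕ}
    (z : ℕ → K) (V : Fin (q + 1) → ℕ → K)
    (htop : (Matrix.of fun a k : Fin (q + 1) => V k a).det ≠ 0) (hq : q ≤ d) :
    (∃ c : Fin (q + 1) → K, ∀ β ≤ d, z β = ∑ k, c k * V k β) ↔
      ∀ j < d - q, (borderMatrix q j z V).det = 0 := by
  constructor
  · rintro ⟨c, hc⟩ j hj
    refine Matrix.exists_mulVec_eq_zero_iff.1 ⟨Fin.cons (-1) c, fun h => ?_, ?_⟩
    · simpa using congrFun h 0
    · funext a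
      have : minorRow q j a ≤ d := by
        unfold minorRow
        split_ifs <;> omega
      simp only [borderMatrix, Matrix.mulVec, dotProduct, Matrix.of_apply, Fin.sum_univ_succ,
        Fin.cons_zero, Fin.cons_succ, hc _ this, Pi.zero_apply]
      simp [mul_comm]
  · intro h
    have hinj : ∀ w : Fin (q + 1) → K, (∀ a : Fin (q + 1), ∑ k, w k * V k a = 0) → w = 0 := by
      intro w hw
      by_contra hne
      refine htop (Matrix.exists_mulVec_eq_zero_iff.1 ⟨w, hne, ?_⟩)
      funext a
      simpa [Matrix.mulVec, dotProduct, mul_comm] using hw a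
    set T := Matrix.of fun a k : Fin (q + 1) => V k a with hT
    -- The top `q + 1` rows already determine the coefficients; the bordered minors decide whether
    -- they also work in the remaining rows.
    set c := T⁻¹.mulVec (fun a : Fin (q + 1) => z a) with hcdef
    have hc : ∀ a : Fin (q + 1), z a = ∑ k, c k * V k a := by
      intro a
      have h1 : T.mulVec c = fun a : Fin (q + 1) => z a := by
        rw [hcdef, Matrix.mulVec_mulVec, Matrix.mul_nonsing_inv _ (isUnit_iff_ne_zero.2 htop),
          Matrix.one_mulVec]
      have := congrFun h1 a
      rw [← this]
      simp [T, Matrix.mulVec, dotProduct, mul_comm]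
    refine ⟨c, fun β hβ => ?_⟩
    by_cases hβq : β ≤ q
    · exact hc ⟨β, by omega⟩
    -- A kernel vector of the bordered matrix is a relation between `z` and the `V k`. Its top rows
    -- force `w k.succ = -w 0 * c k`, so `w 0 ≠ 0`, and its last row is the wanted equation in row
    -- `β`.
    · obtain ⟨w, hw0, hw⟩ := Matrix.exists_mulVec_eq_zero_iff.2 (h (β - q - 1) (by omega))
      have hrow : ∀ a : Fin (q + 1 + 1), w 0 * z (minorRow q (β - q - 1) a) +
          ∑ k : Fin (q + 1), w k.succ * V k (minorRow q (β - q - 1) a) = 0 := by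
        intro a
        have := congrFun hw a
        simpa [borderMatrix, Matrix.mulVec, dotProduct, Fin.sum_univ_succ, mul_comm] using this
      have hrow1 : ∀ a : Fin (q + 1), w 0 * z a + ∑ k : Fin (q + 1), w k.succ * V k a = 0 := by
        intro a
        have := hrow a.castSucc
        rwa [show minorRow q (β - q - 1) (a.castSucc : Fin (q + 1 + 1)) = a from if_pos (by
          have := a.2
          simp only [Fin.val_castSucc]
          omega)] at this
      have hrow2 := hrow (Fin.last _)
      rw [show minorRow q (β - q - 1) (Fin.last (q + 1) : Fin (q + 1 + 1)) = β from by
        unfold minorRow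
        rw [if_neg (by simp)]
        omega] at hrow2
      have hcomb : ∀ k : Fin (q + 1), w 0 * c k + w k.succ = 0 := by
        have := hinj (fun k => w 0 * c k + w k.succ) (fun a => by
          rw [← hrow1 a, hc a, Finset.mul_sum, ← Finset.sum_add_distrib]
          exact Finset.sum_congr rfl fun k _ => by ring)
        exact fun k => congrFun this k
      have hw0' : w 0 ≠ 0 := by
        intro h0
        apply hw0
        funext a
        refine Fin.cases h0 (fun k => ?_) a
        simpa [h0] using hcomb k
      have : w 0 * (z β - ∑ k, c k * V k β) = 0 := by
        rw [← hrow2, mul_sub, Finset.mul_sum, sub_eq_add_neg, ← Finset.sum_neg_distrib]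
        congr 1
        refine Finset.sum_congr rfl fun k _ => ?_
        linear_combination (-V k β) * hcomb k
      rcases mul_eq_zero.1 this with h | h
      · exact absurd h hw0'
      · exact sub_eq_zero.1 h

/-! ### The coplanarity conditions and Cramer's rule -/

namespace ChiConfig

variable {d : ℕ} (χ : ChiConfig d)

/-- An enumeration of the coplanarity conditions. -/
def rowEquiv : Fin d ≃ (Σ i : Fin χ.r, Fin (d - χ.q i)) :=
  Fintype.equivOfCardEq (by simp [χ.codim_sum])

section system

variable {R : Type*} [CommRing R] (V : (i : Fin χ.r) → Fin (χ.q i + 1) → ℕ → R)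

/-- The matrix of the coplanarity conditions for the spanning vectors `V`. -/
def coplanarityMatrix : Matrix (Fin d) (Fin d) R :=
  Matrix.of fun s l => (borderMatrix (χ.q (χ.rowEquiv s).1) (χ.rowEquiv s).2
    (fun β => if β = (l : ℕ) + 1 then 1 else 0) (V (χ.rowEquiv s).1)).det

/-- The inhomogeneous part of the coplanarity conditions. -/
def coplanarityVec : Fin d → R :=
  fun s => (borderMatrix (χ.q (χ.rowEquiv s).1) (χ.rowEquiv s).2
    (fun β => if β = 0 then 1 else 0) (V (χ.rowEquiv s).1)).det

/-- The numerators in Cramer's rule for the intersection point. -/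
def cramerVec : Fin d → R :=
  -(χ.coplanarityMatrix V).adjugate.mulVec (χ.coplanarityVec V)

/-- Determinants and adjugates commute with ring homomorphisms. This and the next three lemmas serve
twice: for evaluating smooth functions at a point and for reducing modulo an ideal such as `(ε²)`.
-/
theorem coplanarityMatrix_map {R' : Type*} [CommRing R'] (f : R →+* R') :
    χ.coplanarityMatrix (fun i k β => f (V i k β)) = f.mapMatrix (χ.coplanarityMatrix V) := by
  ext1 s l
  simp only [coplanarityMatrix, Matrix.of_apply, RingHom.mapMatrix_apply, Matrix.map_apply,
    borderMatrix_map, apply_ite f, map_one, map_zero]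

theorem coplanarityVec_map {R' : Type*} [CommRing R'] (f : R →+* R') (s : Fin d) :
    χ.coplanarityVec (fun i k β => f (V i k β)) s = f (χ.coplanarityVec V s) := by
  simp only [coplanarityVec, borderMatrix_map, apply_ite f, map_one, map_zero]

theorem det_coplanarityMatrix_map {R' : Type*} [CommRing R'] (f : R →+* R') :
    (χ.coplanarityMatrix (fun i k β => f (V i k β))).det = f (χ.coplanarityMatrix V).det := by
  rw [coplanarityMatrix_map, RingHom.map_det]

theorem cramerVec_map {R' : Type*} [CommRing R'] (f : R →+* R') (s : Fin d) :
    χ.cramerVec (fun i k β => f (V i k β)) s = f (χ.cramerVec V s) := by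
  simp only [cramerVec, Pi.neg_apply, Matrix.mulVec, dotProduct, map_neg, map_sum, map_mul,
    coplanarityVec_map, coplanarityMatrix_map, ← RingHom.map_adjugate]
  rfl

end system

theorem det_coplanarityMatrix_ne_zero (hχ : χ.Nondegenerate) :
    (χ.coplanarityMatrix (fun i k β => χ.p i k ^ β / (β.factorial : ℝ))).det ≠ 0 := by
  have h : χ.coplanarityMatrix (fun i k β => χ.p i k ^ β / (β.factorial : ℝ))
      = χ.leadingMatrix.submatrix χ.rowEquiv id := rfl
  rw [h]
  intro h0
  obtain ⟨v, hv, hv0⟩ := Matrix.exists_mulVec_eq_zero_iff.2 h0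
  apply hv
  apply hχ.1
  rw [Matrix.mulVec_zero]
  funext s
  have := congrFun hv0 (χ.rowEquiv.symm s)
  simpa [Matrix.mulVec, dotProduct, Matrix.submatrix] using this

/-- Cramer's rule for the coplanarity conditions. -/
theorem minors_eq_zero_iff {K : Type*} [Field K] (V : (i : Fin χ.r) → Fin (χ.q i + 1) → ℕ → K)
    (hD : (χ.coplanarityMatrix V).det ≠ 0) (z : ℕ → K) :
    (∀ i, ∀ j < d - χ.q i, (borderMatrix (χ.q i) j z (V i)).det = 0) ↔
      ∃ t : K, z 0 = t * (χ.coplanarityMatrix V).det ∧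
        ∀ l : Fin d, z ((l : ℕ) + 1) = t * χ.cramerVec V l := by
  -- Expanding `z` in the standard basis makes each bordered minor an affine form in `z 1, …, z d`,
  -- with constant term proportional to `z 0`.
  have hlin : ∀ s : Fin d,
      (borderMatrix (χ.q (χ.rowEquiv s).1) (χ.rowEquiv s).2 z (V (χ.rowEquiv s).1)).det
        = z 0 * χ.coplanarityVec V s
          + (χ.coplanarityMatrix V).mulVec (fun l : Fin d => z ((l : ℕ) + 1)) s := by
    intro s
    rw [det_borderMatrix_congr (z' := fun β => ∑ l ∈ Finset.range (d + 1),
      z l * (if β = l then 1 else 0)) (χ.rowEquiv s).2.2 _ (fun β hβ => by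
        simp only [mul_ite, mul_one, mul_zero]
        rw [Finset.sum_ite_eq, if_pos (Finset.mem_range.2 (by omega))]),
      det_borderMatrix_sum, Finset.sum_range_succ', add_comm]
    congr 1
    simp only [Matrix.mulVec, dotProduct, coplanarityMatrix, Matrix.of_apply]
    rw [Finset.sum_range]
    exact Finset.sum_congr rfl fun l _ => mul_comm _ _
  have hall : (∀ i, ∀ j < d - χ.q i, (borderMatrix (χ.q i) j z (V i)).det = 0) ↔
      (χ.coplanarityMatrix V).mulVec (fun l : Fin d => z ((l : ℕ) + 1))
        = -(z 0 • χ.coplanarityVec V) := by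
    constructor
    · intro h
      funext s
      have := h _ _ (χ.rowEquiv s).2.2
      rw [hlin] at this
      simp only [Pi.neg_apply, Pi.smul_apply, smul_eq_mul]
      linear_combination this
    · intro h i j hj
      obtain ⟨s, hs⟩ := χ.rowEquiv.surjective ⟨i, ⟨j, hj⟩⟩
      have h2 := hlin s
      rw [h, hs] at h2
      simp only [Pi.neg_apply, Pi.smul_apply, smul_eq_mul] at h2
      rw [h2]
      ring
  rw [hall]
  set A := χ.coplanarityMatrix V
  have hA : A.mulVec (χ.cramerVec V) = -(A.det • χ.coplanarityVec V) := by
    rw [cramerVec, Matrix.mulVec_neg, Matrix.mulVec_mulVec, Matrix.mul_adjugate,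
      Matrix.smul_mulVec, Matrix.one_mulVec]
  constructor
  · intro h
    have h2 : A.det • (fun l : Fin d => z ((l : ℕ) + 1)) = z 0 • χ.cramerVec V := by
      rw [← Matrix.one_mulVec (fun l : Fin d => z ((l : ℕ) + 1)), ← Matrix.smul_mulVec,
        ← Matrix.adjugate_mul, ← Matrix.mulVec_mulVec, h, cramerVec, Matrix.mulVec_neg,
        Matrix.mulVec_smul, smul_neg]
    refine ⟨z 0 / A.det, by field_simp, fun l => ?_⟩
    have := congrFun h2 l
    simp only [Pi.smul_apply, smul_eq_mul] at this
    field_simp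
    linear_combination this
  · rintro ⟨t, h0, ht⟩
    rw [show (fun l : Fin d => z ((l : ℕ) + 1)) = t • χ.cramerVec V from funext ht,
      Matrix.mulVec_smul, hA, h0, smul_neg, smul_smul]

/-- Dependence of determinant and numerators on the spanning vectors, modulo an ideal. -/
theorem coplanarity_sub_mem {R : Type*} [CommRing R] {I : Ideal R}
    {V V' : (i : Fin χ.r) → Fin (χ.q i + 1) → ℕ → R}
    (h : ∀ i k β, V i k β - V' i k β ∈ I) :
    (χ.coplanarityMatrix V).det - (χ.coplanarityMatrix V').det ∈ I ∧
      ∀ l, χ.cramerVec V l - χ.cramerVec V' l ∈ I := by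
  have e : (fun i k β => Ideal.Quotient.mk I (V i k β))
      = (fun i k β => Ideal.Quotient.mk I (V' i k β)) := by
    funext i k β
    exact Ideal.Quotient.eq.2 (h i k β)
  constructor
  · rw [← Ideal.Quotient.eq, ← det_coplanarityMatrix_map, ← det_coplanarityMatrix_map, e]
  · intro l
    rw [← Ideal.Quotient.eq, ← cramerVec_map, ← cramerVec_map, e]

end ChiConfig

end

/-! ### Moving frames, normalization and monodromy -/

noncomputable section

theorem ContDiff.iteratedDeriv_infty {E : Type*} [NormedAddCommGroup E] [NormedSpace ℝ E]
    {f : ℝ → E} (hf : ContDiff ℝ ∞ f) (k : ℕ) : ContDiff ℝ ∞ (iteratedDeriv k f) := by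
  induction k with
  | zero => simpa using hf
  | succ k ih => rw [iteratedDeriv_succ]; exact ih.deriv'

theorem iteratedDeriv_iteratedDeriv {E : Type*} [NormedAddCommGroup E] [NormedSpace ℝ E]
    (f : ℝ → E) (j k : ℕ) : iteratedDeriv j (iteratedDeriv k f) = iteratedDeriv (j + k) f := by
  simp only [iteratedDeriv_eq_iterate, Function.iterate_add_apply]

theorem iteratedDeriv_apply_fin {n : ℕ} {Γ : ℝ → Fin n → ℝ} (hΓ : ContDiff ℝ ∞ Γ) (k : ℕ)
    (x : ℝ) (i : Fin n) : iteratedDeriv k Γ x i = iteratedDeriv k (fun y => Γ y i) x := by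
  induction k generalizing Γ with
  | zero => simp
  | succ k ih =>
    rw [iteratedDeriv_succ', iteratedDeriv_succ', ih hΓ.deriv']
    congr 1
    funext y
    rw [deriv_pi fun i => ((contDiff_pi.1 hΓ i).differentiable (by norm_num)) y]

theorem iteratedDeriv_clm_comp {E F : Type*} [NormedAddCommGroup E] [NormedSpace ℝ E]
    [NormedAddCommGroup F] [NormedSpace ℝ F] (L : E →L[ℝ] F) {f : ℝ → E} (hf : ContDiff ℝ ∞ f)
    (k : ℕ) (x : ℝ) : iteratedDeriv k (fun y => L (f y)) x = L (iteratedDeriv k f x) := by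
  induction k generalizing f with
  | zero => simp
  | succ k ih =>
    rw [iteratedDeriv_succ', iteratedDeriv_succ', ← ih hf.deriv']
    congr 1
    funext y
    exact (L.hasFDerivAt.comp_hasDerivAt y ((hf.differentiable (by norm_num)) y).hasDerivAt).deriv

section matrixSmooth

variable {H : Type*} [NormedAddCommGroup H] [NormedSpace ℝ H] {n : Type*} [Fintype n]
  [DecidableEq n] {s : Set H}

theorem ContDiffOn.matrix_det {A : H → Matrix n n ℝ}
    (h : ∀ i j, ContDiffOn ℝ ∞ (fun x => A x i j) s) : ContDiffOn ℝ ∞ (fun x => (A x).det) s := by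
  simp only [Matrix.det_apply]
  refine ContDiffOn.sum fun σ _ => ?_
  refine ContDiffOn.const_smul _ ?_
  exact contDiffOn_prod fun i _ => h _ _

theorem ContDiffOn.matrix_adjugate {A : H → Matrix n n ℝ}
    (h : ∀ i j, ContDiffOn ℝ ∞ (fun x => A x i j) s) (i j : n) :
    ContDiffOn ℝ ∞ (fun x => (A x).adjugate i j) s := by
  simp only [Matrix.adjugate_apply]
  refine ContDiffOn.matrix_det fun k l => ?_
  simp only [Matrix.updateRow_apply]
  split_ifs
  · exact contDiffOn_const
  · exact h k l

end matrixSmooth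

variable {d : ℕ}

/-- The matrix with columns `Γ, Γ', …, Γ^(d)`. -/
def curveFrame (Γ : ℝ → Fin (d + 1) → ℝ) (x : ℝ) : Matrix (Fin (d + 1)) (Fin (d + 1)) ℝ :=
  Matrix.of fun i j : Fin (d + 1) => iteratedDeriv (j : ℕ) Γ x i

/-- Coordinates with respect to the moving frame, up to the factor `curveWronskian Γ x`. -/
def frameCoord (Γ : ℝ → Fin (d + 1) → ℝ) (x : ℝ) (w : Fin (d + 1) → ℝ) : Fin (d + 1) → ℝ :=
  (curveFrame Γ x).adjugate.mulVec w

theorem det_curveFrame (Γ : ℝ → Fin (d + 1) → ℝ) (x : ℝ) :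
    (curveFrame Γ x).det = curveWronskian Γ x := rfl

theorem curveFrame_mulVec (Γ : ℝ → Fin (d + 1) → ℝ) (x : ℝ) (c : Fin (d + 1) → ℝ) :
    (curveFrame Γ x).mulVec c = ∑ j : Fin (d + 1), c j • iteratedDeriv (j : ℕ) Γ x := by
  funext i
  simp [curveFrame, Matrix.mulVec, dotProduct, Finset.sum_apply, mul_comm]

section

variable {Γ : ℝ → Fin (d + 1) → ℝ} {x : ℝ}

theorem frameCoord_mulVec (hW : curveWronskian Γ x = 1) (c : Fin (d + 1) → ℝ) :
    frameCoord Γ x ((curveFrame Γ x).mulVec c) = c := by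
  rw [frameCoord, Matrix.mulVec_mulVec, Matrix.adjugate_mul, det_curveFrame, hW, one_smul,
    Matrix.one_mulVec]

theorem curveFrame_mulVec_frameCoord (hW : curveWronskian Γ x = 1) (w : Fin (d + 1) → ℝ) :
    (curveFrame Γ x).mulVec (frameCoord Γ x w) = w := by
  rw [frameCoord, Matrix.mulVec_mulVec, Matrix.mul_adjugate, det_curveFrame, hW, one_smul,
    Matrix.one_mulVec]

theorem sum_frameCoord (hW : curveWronskian Γ x = 1) (w : Fin (d + 1) → ℝ) :
    ∑ j : Fin (d + 1), frameCoord Γ x w j • iteratedDeriv (j : ℕ) Γ x = w := by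
  rw [← curveFrame_mulVec, curveFrame_mulVec_frameCoord hW]

theorem frameCoord_sum (hW : curveWronskian Γ x = 1) (c : Fin (d + 1) → ℝ) :
    frameCoord Γ x (∑ j : Fin (d + 1), c j • iteratedDeriv (j : ℕ) Γ x) = c := by
  rw [← curveFrame_mulVec, frameCoord_mulVec hW]

theorem frameCoord_iteratedDeriv (hW : curveWronskian Γ x = 1) (j : Fin (d + 1)) :
    frameCoord Γ x (iteratedDeriv (j : ℕ) Γ x) = Pi.single j 1 := by
  rw [← frameCoord_sum hW (Pi.single j 1)]
  congr 1
  rw [Finset.sum_eq_single j] <;> simp +contextual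

theorem frameCoord_add (v w : Fin (d + 1) → ℝ) :
    frameCoord Γ x (v + w) = frameCoord Γ x v + frameCoord Γ x w := Matrix.mulVec_add _ _ _

theorem frameCoord_smul (c : ℝ) (v : Fin (d + 1) → ℝ) :
    frameCoord Γ x (c • v) = c • frameCoord Γ x v := Matrix.mulVec_smul _ _ _

theorem ne_zero_of_curveWronskian_ne_zero (hW : curveWronskian Γ x ≠ 0) : Γ x ≠ 0 := by
  intro h
  refine hW (Matrix.det_eq_zero_of_column_eq_zero 0 fun i => ?_)
  simp [h]

/-- The adjugate is polynomial in the entries of the frame, so no nonvanishing of the Wronskian is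
needed. -/
theorem contDiffOn_frameCoord {I : Set ℝ} (hI : IsOpen I) {F : ℝ → ℝ → Fin (d + 1) → ℝ}
    (hF : ContDiffOn ℝ ∞ (fun z : ℝ × ℝ => F z.1 z.2) (I ×ˢ Set.univ))
    {w : ℝ × ℝ → Fin (d + 1) → ℝ} (hw : ContDiffOn ℝ ∞ w (I ×ˢ Set.univ)) :
    ContDiffOn ℝ ∞ (fun z => frameCoord (F z.1) z.2 (w z)) (I ×ˢ Set.univ) := by
  refine contDiffOn_pi.2 fun i => ?_
  simp only [frameCoord, Matrix.mulVec, dotProduct]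
  refine ContDiffOn.sum fun j _ => ContDiffOn.mul ?_ (contDiffOn_pi.1 hw j)
  refine ContDiffOn.matrix_adjugate (A := fun z : ℝ × ℝ => curveFrame (F z.1) z.2)
    (fun k l => ?_) i j
  exact contDiffOn_pi.1 (contDiffOn_iteratedDeriv_snd hI hF l) k

theorem contDiff_frameCoord (hΓ : ContDiff ℝ ∞ Γ) {w : ℝ × ℝ → Fin (d + 1) → ℝ}
    (hw : ContDiff ℝ ∞ w) : ContDiff ℝ ∞ (fun z : ℝ × ℝ => frameCoord Γ z.2 (w z)) := by
  have := contDiffOn_frameCoord isOpen_univ (F := fun _ => Γ)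
    (hΓ.comp contDiff_snd).contDiffOn (hw.contDiffOn)
  rwa [Set.univ_prod_univ, contDiffOn_univ] at this

/-! ### Rescaling a curve by a function -/

/-- By the Leibniz rule the frame of `fΓ` is the frame of `Γ` times an upper triangular matrix with
constant diagonal entry `f x`. -/
theorem curveWronskian_smul {f : ℝ → ℝ} (hf : ContDiff ℝ ∞ f) (hΓ : ContDiff ℝ ∞ Γ) (x : ℝ) :
    curveWronskian (fun y => f y • Γ y) x = f x ^ (d + 1) * curveWronskian Γ x := by
  set T : Matrix (Fin (d + 1)) (Fin (d + 1)) ℝ := Matrix.of fun k j =>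
    if (k : ℕ) ≤ j then ((j : ℕ).choose k : ℝ) * iteratedDeriv ((j : ℕ) - k) f x else 0 with hT
  have h : curveFrame (fun y => f y • Γ y) x = curveFrame Γ x * T := by
    ext1 i j
    rw [curveFrame, Matrix.of_apply, iteratedDeriv_apply_fin (Γ := fun y => f y • Γ y) (hf.smul hΓ)]
    simp only [Pi.smul_apply, smul_eq_mul, mul_comm (f _)]
    rw [iteratedDeriv_fun_mul ((contDiff_pi.1 hΓ i).contDiffAt.of_le (by exact_mod_cast le_top))
      (hf.contDiffAt.of_le (by exact_mod_cast le_top)), Matrix.mul_apply]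
    have hj := j.2
    rw [Finset.sum_subset (Finset.range_subset_range.2 (by omega : (j : ℕ) + 1 ≤ d + 1)) (fun k _ hk => by
      rw [Nat.choose_eq_zero_of_lt (by simpa using hk)]; simp), Finset.sum_range]
    refine Finset.sum_congr rfl fun k _ => ?_
    simp only [hT, curveFrame, Matrix.of_apply]
    rw [iteratedDeriv_apply_fin hΓ]
    split_ifs with hk
    · ring
    · rw [Nat.choose_eq_zero_of_lt (by omega)]; simp
  have hup : T.IsUpperTriangular := by
    intro k j hkj
    have : (j : ℕ) < k := hkj
    rw [hT, Matrix.of_apply, if_neg (by omega)]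
  rw [← det_curveFrame, h, Matrix.det_mul, Matrix.det_of_isUpperTriangular hup, det_curveFrame]
  simp [hT, mul_comm]

/-- Two curves with constant Wronskians that are pointwise proportional have a constant ratio. -/
theorem exists_const_ratio {Γ₁ Γ₂ : ℝ → Fin (d + 1) → ℝ} (h₁ : ContDiff ℝ ∞ Γ₁)
    (h₂ : ContDiff ℝ ∞ Γ₂) {w₁ w₂ : ℝ} (hw₁ : w₁ ≠ 0) (hw₂ : w₂ ≠ 0)
    (hW₁ : ∀ x, curveWronskian Γ₁ x = w₁) (hW₂ : ∀ x, curveWronskian Γ₂ x = w₂)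
    (h : ∀ x, ∃ c : ℝ, Γ₂ x = c • Γ₁ x) :
    ∃ c : ℝ, c ^ (d + 1) * w₁ = w₂ ∧ ∀ x, Γ₂ x = c • Γ₁ x := by
  have hpos : ∀ x, (∑ i, Γ₁ x i * Γ₁ x i) ≠ 0 := by
    intro x h0
    refine ne_zero_of_curveWronskian_ne_zero (Γ := Γ₁) (x := x) (by rw [hW₁]; exact hw₁) ?_
    funext i
    have := (Finset.sum_eq_zero_iff_of_nonneg (fun i _ => mul_self_nonneg (Γ₁ x i))).1 h0 i
      (Finset.mem_univ i)
    simpa using this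
  -- The ratio is written as a quotient of inner products so that its smoothness is visible.
  set c : ℝ → ℝ := fun x => (∑ i, Γ₂ x i * Γ₁ x i) / ∑ i, Γ₁ x i * Γ₁ x i with hc
  have hcs : ContDiff ℝ ∞ c := by
    have a1 := contDiff_pi.1 h₁
    have a2 := contDiff_pi.1 h₂
    exact ContDiff.div (ContDiff.sum fun i _ => (a2 i).mul (a1 i))
      (ContDiff.sum fun i _ => (a1 i).mul (a1 i)) hpos
  have hce : ∀ x, Γ₂ x = c x • Γ₁ x := by
    intro x
    obtain ⟨k, hk⟩ := h x
    have : c x = k := by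
      simp only [hc, hk, Pi.smul_apply, smul_eq_mul, mul_assoc, ← Finset.mul_sum]
      exact mul_div_cancel_right₀ _ (hpos x)
    rw [this, hk]
  -- By `curveWronskian_smul` the power `c^(d+1)` is constant. Its derivative vanishes while `c ≠
  -- 0`, hence `c' = 0`.
  have hpow : ∀ x, c x ^ (d + 1) * w₁ = w₂ := by
    intro x
    rw [← hW₂ x, show Γ₂ = fun y => c y • Γ₁ y from funext hce, curveWronskian_smul hcs h₁, hW₁]
  have hc0 : ∀ x, c x ≠ 0 := by
    intro x h0
    have := hpow x
    rw [h0] at this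
    simp at this
    exact hw₂ this.symm
  have hconst : ∀ x, c x = c 0 := by
    have hd : Differentiable ℝ c := hcs.differentiable (by norm_num)
    refine fun x => is_const_of_deriv_eq_zero hd (fun y => ?_) x 0
    have h1 : HasDerivAt (fun y => c y ^ (d + 1)) (((d + 1 : ℕ) : ℝ) * c y ^ d * deriv c y) y := by
      simpa using (hd y).hasDerivAt.fun_pow (d + 1)
    have h2 : (fun y => c y ^ (d + 1)) = fun _ => w₂ / w₁ := by
      funext y
      rw [← hpow y]
      field_simp
    rw [h2] at h1
    have h3 := h1.unique (hasDerivAt_const y _)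
    have h4 : ((d + 1 : ℕ) : ℝ) * c y ^ d ≠ 0 :=
      mul_ne_zero (by positivity) (pow_ne_zero _ (hc0 y))
    exact (mul_eq_zero.1 h3).resolve_left h4
  exact ⟨c 0, hpow 0, fun x => by rw [hce x, hconst x]⟩

theorem curveFrame_mulVec_left (M : Matrix (Fin (d + 1)) (Fin (d + 1)) ℝ) (hΓ : ContDiff ℝ ∞ Γ)
    (x : ℝ) : curveFrame (fun y => M.mulVec (Γ y)) x = M * curveFrame Γ x := by
  ext1 i j
  have := iteratedDeriv_clm_comp (Matrix.mulVecLin M).toContinuousLinearMap hΓ j x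
  have h2 : iteratedDeriv (j : ℕ) (fun y => M.mulVec (Γ y)) x
      = M.mulVec (iteratedDeriv (j : ℕ) Γ x) := this
  rw [curveFrame, Matrix.of_apply, h2]
  rfl

/-! ### Monodromy -/

/-- A projective monodromy acts on lifts only up to a scalar function of `x`. Both `BΓ` and the
shifted `Γ` have constant Wronskian, so the scalar is a constant, and absorbing it into the matrix
gives determinant one. -/
theorem exists_monodromy_matrix {γ : ℝ → Projectivization ℝ (Fin (d + 1) → ℝ)}
    (hΓ : IsNormalizedLift γ Γ) (hγ : HasMonodromy γ) :
    ∃ M : Matrix (Fin (d + 1)) (Fin (d + 1)) ℝ, M.det = 1 ∧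
      ∀ x, Γ (x + 2 * Real.pi) = M.mulVec (Γ x) := by
  obtain ⟨M, hM⟩ := hγ
  set B := LinearMap.toMatrix' M.toLinearMap with hB
  have hBdet : B.det ≠ 0 := by
    have h := LinearEquiv.isUnit_det' M
    rw [← LinearMap.det_toMatrix'] at h
    exact h.ne_zero
  have hBv : ∀ v, B.mulVec v = M v := fun v => LinearMap.toMatrix'_mulVec M.toLinearMap v
  have hshift : ContDiff ℝ ∞ fun x => Γ (x + 2 * Real.pi) :=
    hΓ.smooth.comp (contDiff_id.add contDiff_const)
  have hBs : ContDiff ℝ ∞ fun x => B.mulVec (Γ x) :=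
    (Matrix.mulVecLin B).toContinuousLinearMap.contDiff.comp hΓ.smooth
  obtain ⟨c, hc, hcx⟩ := exists_const_ratio (Γ₁ := fun x => B.mulVec (Γ x))
    (Γ₂ := fun x => Γ (x + 2 * Real.pi)) hBs hshift hBdet one_ne_zero
    (fun x => by
      rw [← det_curveFrame, curveFrame_mulVec_left B hΓ.smooth, Matrix.det_mul, det_curveFrame,
        hΓ.wronskian, mul_one])
    (fun x => by
      rw [← hΓ.wronskian (x + 2 * Real.pi)]
      simp only [curveWronskian, iteratedDeriv_comp_add_const])
    (fun x => by
      obtain ⟨h0, h1⟩ := hΓ.lift x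
      obtain ⟨h2, h3⟩ := hΓ.lift (x + 2 * Real.pi)
      have h4 := hM x
      rw [← h1, ← h3, Projectivization.map_mk, Projectivization.mk_eq_mk_iff'] at h4
      obtain ⟨a, ha⟩ := h4
      refine ⟨a, ?_⟩
      rw [hBv, ← ha]
      rfl)
  refine ⟨c • B, ?_, fun x => ?_⟩
  · rw [Matrix.det_smul, Fintype.card_fin, hc]
  · rw [Matrix.smul_mulVec, hcx]

theorem iteratedDeriv_add_period {M : Matrix (Fin (d + 1)) (Fin (d + 1)) ℝ} {T : ℝ}
    (hΓ : ContDiff ℝ ∞ Γ) (hM : ∀ x, Γ (x + T) = M.mulVec (Γ x)) (k : ℕ) (x : ℝ) :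
    iteratedDeriv k Γ (x + T) = M.mulVec (iteratedDeriv k Γ x) := by
  have := iteratedDeriv_clm_comp (Matrix.mulVecLin M).toContinuousLinearMap hΓ k x
  have h2 : iteratedDeriv k (fun y => M.mulVec (Γ y)) x = M.mulVec (iteratedDeriv k Γ x) := this
  rw [← h2, ← funext hM, iteratedDeriv_comp_add_const]

/-- The matrix `M` carries the frame at `x` to the frame at `x + T`, so corresponding vectors have
equal coordinates. -/
theorem frameCoord_add_period {M : Matrix (Fin (d + 1)) (Fin (d + 1)) ℝ} {T : ℝ}
    (hΓ : ContDiff ℝ ∞ Γ) (hM : ∀ x, Γ (x + T) = M.mulVec (Γ x))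
    (hW : ∀ x, curveWronskian Γ x = 1) (w : Fin (d + 1) → ℝ) (x : ℝ) :
    frameCoord Γ (x + T) (M.mulVec w) = frameCoord Γ x w := by
  have h : M.mulVec w = (curveFrame Γ (x + T)).mulVec (frameCoord Γ x w) := by
    conv_lhs => rw [← sum_frameCoord (hW x) w]
    rw [curveFrame_mulVec, Matrix.mulVec_sum]
    simp only [Matrix.mulVec_smul, iteratedDeriv_add_period hΓ hM]
  rw [h, frameCoord_mulVec (hW _)]

/-! ### The differential operator of a curve -/

theorem laxOp_act {E : Type*} [NormedAddCommGroup E] [NormedSpace ℝ E] (u : Fin d → ℝ → ℝ)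
    (f : ℝ → E) (x : ℝ) : (laxOp u).act f x = iteratedDeriv (d + 1) f x +
      ∑ i : Fin d, u i x • iteratedDeriv (i : ℕ) f x := by
  rw [DiffOp.act, Fin.sum_univ_castSucc, Fin.sum_univ_castSucc, add_comm]
  simp [laxOp]

theorem iteratedDeriv_succ_eq {u : Fin d → ℝ → ℝ} (hL : ∀ x, (laxOp u).act Γ x = 0) (x : ℝ) :
    iteratedDeriv (d + 1) Γ x = -∑ i : Fin d, u i x • iteratedDeriv (i : ℕ) Γ x := by
  have := hL x
  rw [laxOp_act] at this
  exact eq_neg_of_add_eq_zero_left this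

/-- The last coordinate is zero because `L` has no `∂^d` term; this is what later removes the linear
term in `ε`. -/
theorem frameCoord_iteratedDeriv_succ {u : Fin d → ℝ → ℝ} (hL : ∀ x, (laxOp u).act Γ x = 0)
    (hW : curveWronskian Γ x = 1) : frameCoord Γ x (iteratedDeriv (d + 1) Γ x)
      = Fin.snoc (α := fun _ => ℝ) (fun i : Fin d => -u i x) 0 := by
  rw [← frameCoord_sum hW (Fin.snoc (α := fun _ => ℝ) (fun i : Fin d => -u i x) 0),
    Fin.sum_univ_castSucc, iteratedDeriv_succ_eq hL]
  simp

/-- Smoothness, periodicity and time differentiability of the coefficients of `L` are all read off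
from this formula. -/
theorem laxOp_coeff_eq {u : Fin d → ℝ → ℝ} (hL : ∀ x, (laxOp u).act Γ x = 0)
    (hW : ∀ x, curveWronskian Γ x = 1) (i : Fin d) (x : ℝ) :
    u i x = -frameCoord Γ x (iteratedDeriv (d + 1) Γ x) i.castSucc := by
  rw [frameCoord_iteratedDeriv_succ hL (hW x)]
  simp

theorem contDiff_laxOp_coeff {u : Fin d → ℝ → ℝ} (hL : ∀ x, (laxOp u).act Γ x = 0)
    (hΓ : ContDiff ℝ ∞ Γ) (hW : ∀ x, curveWronskian Γ x = 1) (i : Fin d) :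
    ContDiff ℝ ∞ (u i) := by
  have h := contDiff_pi.1 (contDiff_frameCoord hΓ (w := fun z => iteratedDeriv (d + 1) Γ z.2)
    ((hΓ.iteratedDeriv_infty _).comp contDiff_snd)) i.castSucc
  have h2 := (h.comp (contDiff_const.prodMk contDiff_id : ContDiff ℝ ∞ fun x : ℝ => ((0 : ℝ), x))).neg
  rw [show u i = _ from funext fun x => laxOp_coeff_eq hL hW i x]
  exact h2

theorem periodic_laxOp_coeff {γ : ℝ → Projectivization ℝ (Fin (d + 1) → ℝ)}
    {u : Fin d → ℝ → ℝ} (hL : ∀ x, (laxOp u).act Γ x = 0)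
    (hΓ : IsNormalizedLift γ Γ) (hγ : HasMonodromy γ) (i : Fin d) :
    Function.Periodic (u i) (2 * Real.pi) := by
  obtain ⟨M, -, hM⟩ := exists_monodromy_matrix hΓ hγ
  intro x
  rw [laxOp_coeff_eq hL hΓ.wronskian, laxOp_coeff_eq hL hΓ.wronskian i x,
    iteratedDeriv_add_period hΓ.smooth hM, frameCoord_add_period hΓ.smooth hM hΓ.wronskian]

end

end

/-! ### The Wronskian of a perturbed curve -/

noncomputable section

/-- The algebra of smooth functions on the plane. -/
def smoothRing : Subalgebra ℝ (ℝ × ℝ → ℝ) where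
  carrier := {f | ContDiff ℝ ∞ f}
  mul_mem' {f g} hf hg := by
    rw [Set.mem_ofPred_eq] at *
    exact hf.mul hg
  add_mem' {f g} hf hg := by
    rw [Set.mem_ofPred_eq] at *
    exact hf.add hg
  algebraMap_mem' c := by
    rw [Set.mem_ofPred_eq]
    exact contDiff_const (c := c)

theorem mem_smoothRing {f : ℝ × ℝ → ℝ} : f ∈ smoothRing ↔ ContDiff ℝ ∞ f := Iff.rfl

/-- Evaluation of a smooth function at a point. -/
def smoothRing.ev (z : ℝ × ℝ) : smoothRing →+* ℝ :=
  (Pi.evalRingHom (fun _ : ℝ × ℝ => ℝ) z).comp smoothRing.val.toRingHom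

theorem smoothRing.ev_apply (z : ℝ × ℝ) (f : smoothRing) : smoothRing.ev z f = f.1 z := rfl

theorem smoothRing.ev_algebraMap (z : ℝ × ℝ) (c : ℝ) :
    smoothRing.ev z (algebraMap ℝ smoothRing c) = c := rfl

/-- The coordinate function `(ε, x) ↦ ε`. -/
def smoothRing.eps : smoothRing := ⟨fun z => z.1, mem_smoothRing.2 contDiff_fst⟩

theorem smoothRing.ev_eps (z : ℝ × ℝ) : smoothRing.ev z smoothRing.eps = z.1 := rfl

variable {d : ℕ}

theorem curveFrame_eq_mul {Γ : ℝ → Fin (d + 1) → ℝ} {x : ℝ} (hW : curveWronskian Γ x = 1)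
    (G : ℝ → Fin (d + 1) → ℝ) : curveFrame G x = curveFrame Γ x *
      Matrix.of fun i j : Fin (d + 1) => frameCoord Γ x (iteratedDeriv (j : ℕ) G x) i := by
  ext1 i j
  rw [Matrix.mul_apply]
  exact (congrFun (curveFrame_mulVec_frameCoord hW (iteratedDeriv (j : ℕ) G x)) i).symm

theorem curveWronskian_eq_det {Γ : ℝ → Fin (d + 1) → ℝ} {x : ℝ} (hW : curveWronskian Γ x = 1)
    (G : ℝ → Fin (d + 1) → ℝ) : curveWronskian G x =
      (Matrix.of fun i j : Fin (d + 1) => frameCoord Γ x (iteratedDeriv (j : ℕ) G x) i).det := by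
  rw [← det_curveFrame, curveFrame_eq_mul hW, Matrix.det_mul, det_curveFrame, hW, one_mul]

/-- The matrix of `Γ^(j) ↦ Γ^(j + k)` in the moving frame. -/
def frameShift (Γ : ℝ → Fin (d + 1) → ℝ) (k : ℕ) (x : ℝ) : Matrix (Fin (d + 1)) (Fin (d + 1)) ℝ :=
  Matrix.of fun i j : Fin (d + 1) => frameCoord Γ x (iteratedDeriv ((j : ℕ) + k) Γ x) i

section traces

variable {m : ℕ} {Γ : ℝ → Fin (m + 2 + 1) → ℝ} {u : Fin (m + 2) → ℝ → ℝ} {x : ℝ}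

theorem frameShift_of_le (hW : curveWronskian Γ x = 1) (k : ℕ) (i j : Fin (m + 2 + 1))
    (h : (j : ℕ) + k < m + 2 + 1) : frameShift Γ k x i j = if (i : ℕ) = j + k then 1 else 0 := by
  have := congrFun (frameCoord_iteratedDeriv hW ⟨(j : ℕ) + k, h⟩) i
  rw [frameShift, Matrix.of_apply]
  simp only at this
  rw [this, Pi.single_apply]
  simp [Fin.ext_iff]

theorem frameShift_one_last (hL : ∀ x, (laxOp u).act Γ x = 0) (hW : curveWronskian Γ x = 1)
    (i : Fin (m + 2 + 1)) : frameShift Γ 1 x i (Fin.last _)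
      = Fin.snoc (α := fun _ => ℝ) (fun i : Fin (m + 2) => -u i x) 0 i :=
  congrFun (frameCoord_iteratedDeriv_succ hL hW) i

theorem trace_frameShift_one (hL : ∀ x, (laxOp u).act Γ x = 0) (hW : curveWronskian Γ x = 1) :
    (frameShift Γ 1 x).trace = 0 := by
  rw [Matrix.trace, Fin.sum_univ_castSucc]
  simp only [Matrix.diag_apply, frameShift_one_last hL hW, Fin.snoc_last, add_zero]
  refine Finset.sum_eq_zero fun j _ => ?_
  rw [frameShift_of_le hW _ _ _ (by have := j.2; simp only [Fin.val_castSucc]; omega)]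
  simp

/-- `frameShift Γ 1 x` is a companion matrix. A diagonal entry of its square is a closed path of two
steps, and these exist only between the last two indices, once from either end. -/
theorem trace_frameShift_one_sq (hL : ∀ x, (laxOp u).act Γ x = 0) (hW : curveWronskian Γ x = 1) :
    (frameShift Γ 1 x * frameShift Γ 1 x).trace = -2 * u (Fin.last _) x := by
  have h1 : ∀ (i : Fin (m + 2 + 1)) (j : Fin (m + 2)),
      frameShift Γ 1 x i j.castSucc = if (i : ℕ) = j + 1 then 1 else 0 := fun i j =>
    frameShift_of_le hW _ _ _ (by have := j.2; simp only [Fin.val_castSucc]; omega)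
  rw [Matrix.trace, Fin.sum_univ_castSucc]
  simp only [Matrix.diag_apply, Matrix.mul_apply]
  have h2 : ∀ j : Fin (m + 2), ∑ i, frameShift Γ 1 x j.castSucc i * frameShift Γ 1 x i j.castSucc
      = frameShift Γ 1 x j.castSucc j.succ := by
    intro j
    rw [Finset.sum_eq_single j.succ]
    · rw [h1, if_pos (by simp), mul_one]
    · intro i _ hi
      rw [h1 i, if_neg (fun h => hi (Fin.ext (by simpa using h))), mul_zero]
    · simp
  simp only [h2]
  rw [Fin.sum_univ_castSucc, Finset.sum_eq_zero, zero_add, Fin.succ_last, frameShift_one_last hL hW,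
    Fin.snoc_castSucc, Finset.sum_eq_single (Fin.last (m + 1)).castSucc]
  · rw [frameShift_one_last hL hW, h1, if_pos (by simp), Fin.snoc_castSucc]
    ring
  · intro i _ hi
    refine Fin.lastCases (fun hi => ?_) (fun k hk => ?_) i hi
    · simp [frameShift_one_last hL hW]
    · rw [h1, if_neg, zero_mul]
      intro h
      apply hk
      ext
      simpa using h.symm
  · simp
  · intro j _
    rw [← Fin.castSucc_succ, h1, if_neg]
    simp only [Fin.val_castSucc, Fin.val_succ]
    omega

theorem iteratedDeriv_add_two_eq (hΓ : ContDiff ℝ ∞ Γ) (hW : ∀ x, curveWronskian Γ x = 1)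
    (hL : ∀ x, (laxOp u).act Γ x = 0) (x : ℝ) :
    iteratedDeriv (m + 2 + 2) Γ x = -∑ i : Fin (m + 2), (u i x • iteratedDeriv ((i : ℕ) + 1) Γ x
      + deriv (u i) x • iteratedDeriv (i : ℕ) Γ x) := by
  rw [iteratedDeriv_succ, show iteratedDeriv (m + 2 + 1) Γ = _ from
    funext fun x => iteratedDeriv_succ_eq hL x]
  refine HasDerivAt.deriv (HasDerivAt.fun_neg (HasDerivAt.fun_sum fun i _ => ?_))
  have h1 := ((contDiff_laxOp_coeff hL hΓ hW i).differentiable (by norm_num) x).hasDerivAt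
  have h2 := ((hΓ.iteratedDeriv_infty i).differentiable (by norm_num) x).hasDerivAt
  rw [iteratedDeriv_succ]
  exact h1.smul h2

/-- Only the last two diagonal entries survive. One is the `Γ^(d-1)` coordinate of `Γ^(d+1)`, the
other the `Γ^(d)` coordinate of `Γ^(d+2)`; each is `-u_{d-1}`. -/
theorem trace_frameShift_two (hΓ : ContDiff ℝ ∞ Γ) (hW : ∀ x, curveWronskian Γ x = 1)
    (hL : ∀ x, (laxOp u).act Γ x = 0) (x : ℝ) :
    (frameShift Γ 2 x).trace = -2 * u (Fin.last _) x := by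
  rw [Matrix.trace, Fin.sum_univ_castSucc, Fin.sum_univ_castSucc, Finset.sum_eq_zero]
  · have h1 : frameShift Γ 2 x (Fin.last (m + 1)).castSucc (Fin.last (m + 1)).castSucc
        = -u (Fin.last _) x := by
      have := congrFun (frameCoord_iteratedDeriv_succ hL (hW x)) (Fin.last (m + 1)).castSucc
      rw [Fin.snoc_castSucc] at this
      exact this
    have h2 : frameShift Γ 2 x (Fin.last (m + 2)) (Fin.last (m + 2)) = -u (Fin.last _) x := by
      rw [frameShift, Matrix.of_apply, Fin.val_last, iteratedDeriv_add_two_eq hΓ hW hL]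
      rw [frameCoord, Matrix.mulVec_neg, Matrix.mulVec_sum, Pi.neg_apply, Finset.sum_apply]
      congr 1
      have h3 : ∀ i : Fin (m + 2), (curveFrame Γ x).adjugate.mulVec
          (u i x • iteratedDeriv ((i : ℕ) + 1) Γ x + deriv (u i) x • iteratedDeriv (i : ℕ) Γ x)
          (Fin.last (m + 2)) = if i = Fin.last (m + 1) then u i x else 0 := by
        intro i
        have e1 := congrFun (frameCoord_iteratedDeriv (hW x) i.succ) (Fin.last (m + 2))
        have e2 := congrFun (frameCoord_iteratedDeriv (hW x) i.castSucc) (Fin.last (m + 2))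
        rw [Pi.single_apply] at e1 e2
        simp only [Fin.val_succ, Fin.val_castSucc] at e1 e2
        change frameCoord Γ x _ _ = _
        rw [frameCoord_add, frameCoord_smul, frameCoord_smul, Pi.add_apply, Pi.smul_apply,
          Pi.smul_apply, e1, e2, if_neg (Fin.castSucc_lt_last i).ne']
        have hi : Fin.last (m + 2) = i.succ ↔ i = Fin.last (m + 1) := by
          rw [← Fin.succ_last, Fin.succ_inj, eq_comm]
        simp [hi]
      rw [Finset.sum_congr rfl fun i _ => h3 i]
      simp
    rw [Matrix.diag_apply, Matrix.diag_apply, h1, h2]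
    ring
  · intro j _
    rw [Matrix.diag_apply, frameShift_of_le (hW x) _ _ _ (by simp; omega)]
    simp

end traces

theorem contDiff_frameShift {Γ : ℝ → Fin (d + 1) → ℝ} (hΓ : ContDiff ℝ ∞ Γ) (k : ℕ)
    (i j : Fin (d + 1)) : ContDiff ℝ ∞ fun z : ℝ × ℝ => frameShift Γ k z.2 i j :=
  contDiff_pi.1 (contDiff_frameCoord hΓ (w := fun z => iteratedDeriv ((j : ℕ) + k) Γ z.2)
    ((hΓ.iteratedDeriv_infty _).comp contDiff_snd)) i

/-- The curve `Γ + ε a Γ' + ε² b Γ'' + ε³ R`. -/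
def perturbedCurve (Γ : ℝ → Fin (d + 1) → ℝ) (a b : ℝ) (R : ℝ → ℝ → Fin (d + 1) → ℝ) (ε : ℝ)
    (x : ℝ) : Fin (d + 1) → ℝ :=
  Γ x + (ε * a) • iteratedDeriv 1 Γ x + (ε ^ 2 * b) • iteratedDeriv 2 Γ x + ε ^ 3 • R ε x

theorem contDiff_perturbedCurve {Γ : ℝ → Fin (d + 1) → ℝ} (hΓ : ContDiff ℝ ∞ Γ) (a b : ℝ)
    {R : ℝ → ℝ → Fin (d + 1) → ℝ} (hR : ContDiff ℝ ∞ fun z : ℝ × ℝ => R z.1 z.2) :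
    ContDiff ℝ ∞ fun z : ℝ × ℝ => perturbedCurve Γ a b R z.1 z.2 := by
  have h1 := hΓ.iteratedDeriv_infty 1
  have h2 := hΓ.iteratedDeriv_infty 2
  unfold perturbedCurve
  fun_prop

theorem iteratedDeriv_perturbedCurve {Γ : ℝ → Fin (d + 1) → ℝ} (hΓ : ContDiff ℝ ∞ Γ) (a b : ℝ)
    {R : ℝ → ℝ → Fin (d + 1) → ℝ} (hR : ContDiff ℝ ∞ fun z : ℝ × ℝ => R z.1 z.2) (ε : ℝ) (j : ℕ)
    (x : ℝ) : iteratedDeriv j (perturbedCurve Γ a b R ε) x =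
      iteratedDeriv j Γ x + (ε * a) • iteratedDeriv (j + 1) Γ x
        + (ε ^ 2 * b) • iteratedDeriv (j + 2) Γ x + ε ^ 3 • iteratedDeriv j (R ε) x := by
  have hRε : ContDiff ℝ ∞ (R ε) := hR.comp (contDiff_const.prodMk contDiff_id)
  have c0 : ∀ {f : ℝ → Fin (d + 1) → ℝ}, ContDiff ℝ ∞ f → ContDiffAt ℝ j f x := fun h =>
    h.contDiffAt.of_le (by exact_mod_cast le_top)
  have h1 := hΓ.iteratedDeriv_infty 1
  have h2 := hΓ.iteratedDeriv_infty 2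
  have e : perturbedCurve Γ a b R ε = Γ + (ε * a) • iteratedDeriv 1 Γ
      + (ε ^ 2 * b) • iteratedDeriv 2 Γ + ε ^ 3 • R ε := rfl
  have k1 : ContDiff ℝ ∞ ((ε * a) • iteratedDeriv 1 Γ) :=
    show ContDiff ℝ ∞ fun y => (ε * a) • iteratedDeriv 1 Γ y from h1.const_smul (ε * a)
  have k2 : ContDiff ℝ ∞ ((ε ^ 2 * b) • iteratedDeriv 2 Γ) :=
    show ContDiff ℝ ∞ fun y => (ε ^ 2 * b) • iteratedDeriv 2 Γ y from h2.const_smul (ε ^ 2 * b)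
  have k3 : ContDiff ℝ ∞ (ε ^ 3 • R ε) :=
    show ContDiff ℝ ∞ fun y => ε ^ 3 • R ε y from hRε.const_smul (ε ^ 3)
  have k01 : ContDiff ℝ ∞ (Γ + (ε * a) • iteratedDeriv 1 Γ) := hΓ.add k1
  have k012 : ContDiff ℝ ∞ (Γ + (ε * a) • iteratedDeriv 1 Γ + (ε ^ 2 * b) • iteratedDeriv 2 Γ) :=
    k01.add k2
  rw [e, iteratedDeriv_add (c0 k012) (c0 k3), iteratedDeriv_add (c0 k01) (c0 k2),
    iteratedDeriv_add (c0 hΓ) (c0 k1),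
    iteratedDeriv_const_smul_field, iteratedDeriv_const_smul_field, iteratedDeriv_const_smul_field,
    iteratedDeriv_iteratedDeriv, iteratedDeriv_iteratedDeriv]

open smoothRing in
/-- Second order expansion of the Wronskian of a perturbed curve. -/
theorem exists_curveWronskian_expansion (hd : 2 ≤ d) {Γ : ℝ → Fin (d + 1) → ℝ}
    (hΓ : ContDiff ℝ ∞ Γ) (hW : ∀ x, curveWronskian Γ x = 1) {u : Fin d → ℝ → ℝ}
    (hL : ∀ x, (laxOp u).act Γ x = 0) (a b : ℝ)
    {R : ℝ → ℝ → Fin (d + 1) → ℝ} (hR : ContDiff ℝ ∞ fun z : ℝ × ℝ => R z.1 z.2) :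
    ∃ S : ℝ × ℝ → ℝ, Continuous S ∧ ∀ ε x, curveWronskian (perturbedCurve Γ a b R ε) x =
      1 + ε ^ 2 * ((a ^ 2 - 2 * b) * u ⟨d - 1, sub_one_lt_of_two_le hd⟩ x) + ε ^ 3 * S (ε, x) := by
  obtain ⟨m, rfl⟩ : ∃ m, d = m + 2 := ⟨d - 2, by omega⟩
  set N : ℕ → Matrix (Fin (m + 2 + 1)) (Fin (m + 2 + 1)) smoothRing := fun k =>
    Matrix.of fun i j => ⟨fun z => frameShift Γ k z.2 i j, mem_smoothRing.2 (contDiff_frameShift hΓ k i j)⟩ with hN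
  set Z : Matrix (Fin (m + 2 + 1)) (Fin (m + 2 + 1)) smoothRing := Matrix.of fun i j =>
    ⟨fun z => frameCoord Γ z.2 (iteratedDeriv (j : ℕ) (R z.1) z.2) i,
      mem_smoothRing.2 (contDiff_pi.1 (contDiff_frameCoord hΓ (contDiff_iteratedDeriv_snd hR _)) i)⟩ with hZ
  have evN : ∀ k z, (ev z).mapMatrix (N k) = frameShift Γ k z.2 := fun k z => rfl
  -- Expanding in the ring of smooth functions of `(ε, x)` makes the remainder `r` smooth, hence
  -- continuous, with no further estimate.
  obtain ⟨q, r, hq, hdet⟩ := Matrix.exists_det_expansion eps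
    (algebraMap ℝ smoothRing a • N 1) (algebraMap ℝ smoothRing b • N 2) Z
  refine ⟨r.1, (mem_smoothRing.1 r.2).continuous, fun ε x => ?_⟩
  have hev := congrArg (ev (ε, x)) hdet
  have hevq := congrArg (ev (ε, x)) hq
  have htr : ∀ B : Matrix (Fin (m + 2 + 1)) (Fin (m + 2 + 1)) smoothRing,
      ev (ε, x) B.trace = ((ev (ε, x)).mapMatrix B).trace := fun B => by
    simp [Matrix.trace]
  simp only [Matrix.trace_smul, smul_mul_assoc, mul_smul_comm, smul_smul, smul_eq_mul, map_mul,
    map_pow, map_sub, htr, evN, trace_frameShift_one hL (hW x), trace_frameShift_one_sq hL (hW x),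
    ev_algebraMap, map_ofNat] at hevq
  simp only [RingHom.map_det, map_add, map_mul, map_pow, map_one, Matrix.trace_smul, smul_eq_mul,
    htr, evN, trace_frameShift_one hL (hW x), trace_frameShift_two hΓ hW hL x, ev_algebraMap,
    ev_eps] at hev
  have hl : u ⟨m + 2 - 1, by omega⟩ = u (Fin.last (m + 1)) := rfl
  rw [hl, curveWronskian_eq_det (hW x)]
  have hm : (Matrix.of fun i j : Fin (m + 2 + 1) => frameCoord Γ x
      (iteratedDeriv (j : ℕ) (perturbedCurve Γ a b R ε) x) i)
      = 1 + (ev (ε, x)).mapMatrix (eps • algebraMap ℝ smoothRing a • N 1)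
        + (ev (ε, x)).mapMatrix (eps ^ 2 • algebraMap ℝ smoothRing b • N 2)
        + (ev (ε, x)).mapMatrix (eps ^ 3 • Z) := by
    ext1 i j
    rw [Matrix.of_apply, iteratedDeriv_perturbedCurve hΓ a b hR]
    simp only [frameCoord_add, frameCoord_smul, Pi.add_apply, Pi.smul_apply, smul_eq_mul,
      Matrix.add_apply, RingHom.mapMatrix_apply, Matrix.map_apply, Matrix.smul_apply, map_mul,
      map_pow, ev_eps, ev_algebraMap]
    rw [frameCoord_iteratedDeriv (hW x), Pi.single_apply, Matrix.one_apply]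
    simp only [hN, hZ, Matrix.of_apply, frameShift, mul_assoc]
    rfl
  rw [hm, hev, ← ev_apply]
  -- Here `hevq` gives `q = a² u_{d-1}` after halving, and the trace of `bN₂` contributes `-2b
  -- u_{d-1}`.
  linear_combination (ε ^ 2 / 2) * hevq

end

/-! ### From a perturbed curve to the normalized expansion -/

noncomputable section

/-- Second order estimate for `w ^ (-p)` near `w = 1`. -/
theorem abs_rpow_neg_sub_le {w p : ℝ} (hw : 1 / 2 ≤ w) (hp0 : 0 ≤ p) (hp1 : p ≤ 1) :
    |w ^ (-p) - (1 - p * (w - 1))| ≤ 2 * (w - 1) ^ 2 := by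
  have hw0 : 0 < w := by linarith
  -- Bernoulli's inequality for `w` bounds `w^(-p)` below, and for `w⁻¹` it bounds `w^(-p)` above.
  have h1 : w ^ p ≤ 1 + p * (w - 1) := by
    have := rpow_one_add_le_one_add_mul_self (s := w - 1) (by linarith) hp0 hp1
    rwa [add_sub_cancel] at this
  have h2 : w⁻¹ ^ p ≤ 1 + p * (w⁻¹ - 1) := by
    have := rpow_one_add_le_one_add_mul_self (s := w⁻¹ - 1)
      (by have : 0 < w⁻¹ := by positivity
          linarith) hp0 hp1
    rwa [add_sub_cancel] at this
  have hpos : 0 < w ^ p := Real.rpow_pos_of_pos hw0 p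
  have e1 : w ^ (-p) = (w ^ p)⁻¹ := Real.rpow_neg hw0.le p
  have e2 : w ^ (-p) = w⁻¹ ^ p := by rw [e1, Real.inv_rpow hw0.le]
  rw [abs_le]
  constructor
  · have h3 : 1 - p * (w - 1) ≤ w ^ (-p) := by
      rw [e1, ← one_div, le_div_iff₀ hpos]
      by_cases hs : 0 ≤ 1 - p * (w - 1)
      · nlinarith [sq_nonneg (p * (w - 1))]
      · nlinarith
    nlinarith [sq_nonneg (w - 1)]
  · have h3 : p * (w⁻¹ - 1) + p * (w - 1) ≤ 2 * (w - 1) ^ 2 := by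
      have e3 : p * (w⁻¹ - 1) + p * (w - 1) = p * w⁻¹ * (w - 1) ^ 2 := by
        field_simp
        ring
      rw [e3]
      have hwi : w⁻¹ ≤ 2 := by
        rw [inv_le_comm₀ hw0 (by norm_num)]
        linarith
      have : p * w⁻¹ ≤ 2 := by
        have : 0 < w⁻¹ := by positivity
        nlinarith
      exact mul_le_mul_of_nonneg_right this (sq_nonneg _)
    rw [e2]
    linarith

variable {d : ℕ}

theorem opG₁_act (hd : 2 ≤ d) {E : Type*} [NormedAddCommGroup E] [NormedSpace ℝ E] (a : ℝ)
    (f : ℝ → E) (x : ℝ) : (opG₁ d a).act f x = a • iteratedDeriv 1 f x := by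
  rw [DiffOp.act, Finset.sum_eq_single (⟨1, by omega⟩ : Fin (d + 1))]
  · simp [opG₁]
  · intro j _ hj
    rw [opG₁, if_neg (fun h => hj (Fin.ext h)), zero_smul]
  · simp

theorem opG₂_act (hd : 2 ≤ d) {E : Type*} [NormedAddCommGroup E] [NormedSpace ℝ E] (a b : ℝ)
    (w : ℝ → ℝ) (f : ℝ → E) (x : ℝ) : (opG₂ d a b w).act f x = b • iteratedDeriv 2 f x
      + (b * (2 / ((d : ℝ) + 1) * w x) - a ^ 2 / ((d : ℝ) + 1) * w x) • f x := by
  obtain ⟨m, rfl⟩ : ∃ m, d = m + 2 := ⟨d - 2, by omega⟩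
  rw [DiffOp.act, Fin.sum_univ_succ, Fin.sum_univ_succ, Fin.sum_univ_succ, Finset.sum_eq_zero]
  · simp [opG₂]
    abel
  · intro j _
    simp [opG₂]

/-- A perturbed curve that lifts the image of `γ` yields, after normalization, the expansion. -/
theorem ChiConfig.hasExpansion_of_perturbedCurve (χ : ChiConfig d) (hd : 2 ≤ d)
    {γ : ℝ → Projectivization ℝ (Fin (d + 1) → ℝ)} {Γ : ℝ → Fin (d + 1) → ℝ}
    (hΓ : IsNormalizedLift γ Γ) {u : Fin d → ℝ → ℝ} (hL : ∀ x, (laxOp u).act Γ x = 0) (a b : ℝ)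
    {R : ℝ → ℝ → Fin (d + 1) → ℝ} (hR : ContDiff ℝ ∞ fun z : ℝ × ℝ => R z.1 z.2)
    {M : Matrix (Fin (d + 1)) (Fin (d + 1)) ℝ} (hM : M.det = 1)
    (hper : ∀ ε x, perturbedCurve Γ a b R ε (x + 2 * Real.pi)
      = M.mulVec (perturbedCurve Γ a b R ε x))
    {δ : ℝ} (hδ : 0 < δ) (hspan : ∀ ε ∈ Set.Ioo 0 δ, ∀ x,
      ⨅ i, χ.plane ε γ i x = Submodule.span ℝ {perturbedCurve Γ a b R ε x}) :
    χ.HasExpansion γ Γ (opG₁ d a) (opG₂ d a b (u ⟨d - 1, sub_one_lt_of_two_le hd⟩)) := by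
  set G := perturbedCurve Γ a b R with hG
  have hGs : ContDiff ℝ ∞ fun z : ℝ × ℝ => G z.1 z.2 := contDiff_perturbedCurve hΓ.smooth a b hR
  have hGε : ∀ ε, ContDiff ℝ ∞ (G ε) := fun ε => hGs.comp (contDiff_const.prodMk contDiff_id)
  obtain ⟨S, hS, hWS⟩ := exists_curveWronskian_expansion hd hΓ.smooth hΓ.wronskian hL a b hR
  set w := u ⟨d - 1, sub_one_lt_of_two_le hd⟩ with hw
  have hws : ContDiff ℝ ∞ w := contDiff_laxOp_coeff hL hΓ.smooth hΓ.wronskian _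
  set W : ℝ × ℝ → ℝ := fun z => curveWronskian (G z.1) z.2 with hWdef
  have hWsmooth : ContDiff ℝ ∞ W := by
    have := ContDiffOn.matrix_det (s := Set.univ) (A := fun z : ℝ × ℝ => curveFrame (G z.1) z.2)
      fun i j => (contDiff_pi.1 (contDiff_iteratedDeriv_snd hGs j) i).contDiffOn
    exact contDiffOn_univ.1 this
  have hWper : ∀ ε x, W (ε, x + 2 * Real.pi) = W (ε, x) := by
    intro ε x
    have h1 : W (ε, x + 2 * Real.pi) = curveWronskian (fun y => G ε (y + 2 * Real.pi)) x := by
      simp only [hWdef, curveWronskian, iteratedDeriv_comp_add_const]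
    rw [h1, funext (hper ε), ← det_curveFrame, curveFrame_mulVec_left M (hGε ε), Matrix.det_mul, hM,
      one_mul, det_curveFrame]
  -- The Wronskian is one at `ε = 0` and periodic in `x`, so it exceeds `1/2` for small `ε` at all
  -- `x` simultaneously.
  obtain ⟨δ', hδ', hWδ⟩ := exists_forall_mem_of_periodic hWsmooth.continuous Real.two_pi_pos hWper
    (isOpen_Ioi (a := (1 / 2 : ℝ))) (fun x => by
      have := hWS 0 x
      simp only [hWdef, Set.mem_Ioi]
      rw [this]
      norm_num)
  -- Scaling a curve by `f` multiplies its Wronskian by `f^(d+1)`, so `f = W^(-p)` normalizes it.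
  set p : ℝ := 1 / ((d : ℝ) + 1) with hp
  have hd1 : (0 : ℝ) < (d : ℝ) + 1 := by positivity
  have hp0 : 0 ≤ p := by positivity
  have hp1 : p ≤ 1 := by
    rw [hp, div_le_one hd1]
    linarith [(Nat.cast_nonneg d : (0 : ℝ) ≤ d)]
  set ε₀ := min (min δ δ') 1 with hε₀
  have hε₀pos : 0 < ε₀ := lt_min (lt_min hδ hδ') one_pos
  have hW2 : ∀ ε ∈ Set.Ioo 0 ε₀, ∀ x, 1 / 2 < W (ε, x) := fun ε hε x => hWδ ε (by
    rw [abs_of_pos hε.1]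
    exact hε.2.trans_le ((min_le_left _ _).trans (min_le_right _ _))) x
  refine ⟨ε₀, hε₀pos, fun ε x => W (ε, x) ^ (-p) • G ε x, fun ε hε => ?_, fun K hK => ?_⟩
  · have hWpos : ∀ x, 0 < W (ε, x) := fun x => lt_trans (by norm_num) (hW2 ε hε x)
    have hfs : ContDiff ℝ ∞ fun x => W (ε, x) ^ (-p) := by
      refine ContDiff.rpow_const_of_ne ?_ fun x => (hWpos x).ne'
      exact hWsmooth.comp (contDiff_const.prodMk contDiff_id)
    have hf0 : ∀ x, W (ε, x) ^ (-p) ≠ 0 := fun x => (Real.rpow_pos_of_pos (hWpos x) _).ne'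
    have hG0 : ∀ x, G ε x ≠ 0 := fun x =>
      ne_zero_of_curveWronskian_ne_zero (Γ := G ε) (hWpos x).ne'
    have hne : ∀ x, W (ε, x) ^ (-p) • G ε x ≠ 0 := fun x => smul_ne_zero (hf0 x) (hG0 x)
    refine ⟨fun x => Projectivization.mk ℝ _ (hne x), fun x => ?_, ?_, fun x => ⟨hne x, rfl⟩,
      fun x => ?_⟩
    · rw [Projectivization.submodule_mk, hspan ε ⟨hε.1, hε.2.trans_le
        ((min_le_left _ _).trans (min_le_left _ _))⟩ x,
        Submodule.span_singleton_smul_eq (IsUnit.mk0 _ (hf0 x))]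
    · exact hfs.smul (hGε ε)
    · rw [curveWronskian_smul hfs (hGε ε), ← Real.rpow_natCast, ← Real.rpow_mul (hWpos x).le]
      have e : -p * ((d + 1 : ℕ) : ℝ) = -1 := by
        rw [hp]
        push_cast
        field_simp
      rw [e, Real.rpow_neg_one]
      exact inv_mul_cancel₀ (hWpos x).ne'
  · set κ : ℝ → ℝ := fun x => (a ^ 2 - 2 * b) * w x with hκ
    have hKc : IsCompact (Set.Icc (0 : ℝ) 1 ×ˢ K) := isCompact_Icc.prod hK
    have hΓc := hΓ.smooth.continuous
    have hΓ1 := (hΓ.smooth.iteratedDeriv_infty 1).continuous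
    have hΓ2 := (hΓ.smooth.iteratedDeriv_infty 2).continuous
    have hRc := hR.continuous
    have hwc := hws.continuous
    have hGc := hGs.continuous
    obtain ⟨C₁, hC₁⟩ := hKc.exists_bound_of_continuousOn (f := fun z : ℝ × ℝ =>
      R z.1 z.2 - (p * κ z.2) • (a • iteratedDeriv 1 Γ z.2 + (z.1 * b) • iteratedDeriv 2 Γ z.2
        + z.1 ^ 2 • R z.1 z.2)) (by fun_prop)
    obtain ⟨C₂, hC₂⟩ := hKc.exists_bound_of_continuousOn (f := fun z : ℝ × ℝ => G z.1 z.2)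
      hGc.continuousOn
    obtain ⟨C₃, hC₃⟩ := hKc.exists_bound_of_continuousOn (f := S) hS.continuousOn
    obtain ⟨C₄, hC₄⟩ := hKc.exists_bound_of_continuousOn
      (f := fun z : ℝ × ℝ => κ z.2 + z.1 * S z) (by fun_prop)
    refine ⟨C₁ + (C₃ + 2 * C₄ ^ 2) * C₂, fun ε hε x hx => ?_⟩
    have hε1 : ε ≤ 1 := hε.2.le.trans (min_le_right _ _)
    have hε0 : 0 < ε := hε.1
    have hz : ((ε, x) : ℝ × ℝ) ∈ Set.Icc (0 : ℝ) 1 ×ˢ K := ⟨⟨hε0.le, hε1⟩, hx⟩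
    have b1 := hC₁ _ hz
    have b2 := hC₂ _ hz
    have b3 := hC₃ _ hz
    have b4 := hC₄ _ hz
    simp only at b1 b2 b4
    rw [Real.norm_eq_abs] at b3 b4
    have hWe : W (ε, x) - 1 = ε ^ 2 * (κ x + ε * S (ε, x)) := by
      have : W (ε, x) = _ := hWS ε x
      rw [this]
      simp only [hκ]
      ring
    -- The error of replacing the normalizing factor by its second order part `1 - pε²κ`; it is
    -- `O(ε³)` by the Bernoulli estimate.
    set r := W (ε, x) ^ (-p) - (1 - p * (ε ^ 2 * κ x)) with hr
    have hrb : |r| ≤ ε ^ 3 * (C₃ + 2 * C₄ ^ 2) := by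
      have h1 := abs_rpow_neg_sub_le (hW2 ε hε x).le hp0 hp1
      rw [hWe] at h1
      have h2 : r = (W (ε, x) ^ (-p) - (1 - p * (ε ^ 2 * (κ x + ε * S (ε, x)))))
          - p * (ε ^ 3 * S (ε, x)) := by
        rw [hr]
        ring
      have h3 : |p * (ε ^ 3 * S (ε, x))| ≤ ε ^ 3 * C₃ := by
        rw [abs_mul, abs_mul, abs_of_nonneg hp0, abs_of_pos (pow_pos hε0 3)]
        calc p * (ε ^ 3 * |S (ε, x)|) ≤ 1 * (ε ^ 3 * |S (ε, x)|) := by gcongr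
          _ ≤ ε ^ 3 * C₃ := by rw [one_mul]; gcongr
      have h4 : 2 * (ε ^ 2 * (κ x + ε * S (ε, x))) ^ 2 ≤ ε ^ 3 * (2 * C₄ ^ 2) := by
        have h5 : (κ x + ε * S (ε, x)) ^ 2 ≤ C₄ ^ 2 := sq_le_sq' (abs_le.1 b4).1 (abs_le.1 b4).2
        calc 2 * (ε ^ 2 * (κ x + ε * S (ε, x))) ^ 2
            = ε * (ε ^ 3 * (2 * (κ x + ε * S (ε, x)) ^ 2)) := by ring
          _ ≤ 1 * (ε ^ 3 * (2 * (κ x + ε * S (ε, x)) ^ 2)) := by gcongr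
          _ ≤ ε ^ 3 * (2 * C₄ ^ 2) := by rw [one_mul]; gcongr
      rw [h2]
      refine (abs_sub _ _).trans ?_
      linarith
    have hkey : W (ε, x) ^ (-p) • G ε x - (Γ x + ε • (opG₁ d a).act Γ x
        + ε ^ 2 • (opG₂ d a b w).act Γ x) = ε ^ 3 • (R ε x - (p * κ x) •
        (a • iteratedDeriv 1 Γ x + (ε * b) • iteratedDeriv 2 Γ x + ε ^ 2 • R ε x))
        + r • G ε x := by
      have e : W (ε, x) ^ (-p) = 1 - p * (ε ^ 2 * κ x) + r := by rw [hr]; ring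
      have e2 : b * (2 / ((d : ℝ) + 1) * w x) - a ^ 2 / ((d : ℝ) + 1) * w x = -(p * κ x) := by
        simp only [hκ, hp]
        ring
      rw [opG₁_act hd, opG₂_act hd, e, e2, hG, perturbedCurve]
      funext i
      simp only [Pi.add_apply, Pi.sub_apply, Pi.smul_apply, smul_eq_mul]
      ring
    rw [hkey]
    refine (norm_add_le _ _).trans ?_
    rw [norm_smul, norm_smul, Real.norm_eq_abs, Real.norm_eq_abs, abs_of_pos (pow_pos hε0 3)]
    calc _ ≤ ε ^ 3 * C₁ + (ε ^ 3 * (C₃ + 2 * C₄ ^ 2)) * C₂ := by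
          gcongr
          exact (abs_nonneg _).trans hrb
      _ = _ := by ring

end

/-! ### The intersection point in the rescaled moving frame -/

noncomputable section

open smoothRing

variable {d : ℕ}

/-- In the moving frame at `x`, rescaled by powers of `ε`, the point `Γ (x + p ε)` has coordinates
`p ^ β / β!` up to a smooth multiple of `ε²`. -/
theorem exists_rescaled_coord {Γ : ℝ → Fin (d + 1) → ℝ} (hΓ : ContDiff ℝ ∞ Γ)
    (hW : ∀ x, curveWronskian Γ x = 1) {u : Fin d → ℝ → ℝ} (hL : ∀ x, (laxOp u).act Γ x = 0)
    (p : ℝ) : ∃ v : ℕ → smoothRing,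
      (∀ β, v β - algebraMap ℝ smoothRing (p ^ β / (β.factorial : ℝ)) ∈ Ideal.span {eps ^ 2}) ∧
      (∀ β, d < β → v β = algebraMap ℝ smoothRing (p ^ β / (β.factorial : ℝ))) ∧
      ∀ ε x (β : Fin (d + 1)), ε ^ (β : ℕ) * ev (ε, x) (v β) = frameCoord Γ x (Γ (x + p * ε)) β := by
  -- Taylor's formula is taken to order `d + 1`: its remainder `ε^(d+2)`, divided by `ε^β` with `β ≤
  -- d`, still carries a factor `ε²`.
  choose ρ hρ htay using fun i => exists_smooth_taylor_remainder (d + 1) (contDiff_pi.1 hΓ i)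
  have hρs : ContDiff ℝ ∞ fun z : ℝ × ℝ => fun i => ρ i (p * z.1, z.2) := by
    refine contDiff_pi.2 fun i => (hρ i).comp ?_
    fun_prop
  set c : Fin (d + 1) → smoothRing := fun β =>
    ⟨fun z => frameCoord Γ z.2 (iteratedDeriv (d + 1) Γ z.2) β, mem_smoothRing.2
      (contDiff_pi.1 (contDiff_frameCoord hΓ ((hΓ.iteratedDeriv_infty _).comp contDiff_snd)) β)⟩
    with hc
  set s : Fin (d + 1) → smoothRing := fun β =>
    ⟨fun z => frameCoord Γ z.2 (fun i => ρ i (p * z.1, z.2)) β, mem_smoothRing.2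
      (contDiff_pi.1 (contDiff_frameCoord hΓ hρs) β)⟩ with hs
  have hclast : c (Fin.last d) = 0 := by
    apply Subtype.ext
    funext z
    have := congrFun (frameCoord_iteratedDeriv_succ hL (hW z.2)) (Fin.last d)
    simpa [hc] using this
  -- The Taylor terms up to order `d` contribute the constants, and the last two terms are divided
  -- by `ε^β`. Beyond `d` the coordinate is kept constant, so that the congruence modulo `ε²` holds
  -- for every `β`.
  refine ⟨fun β => algebraMap ℝ smoothRing (p ^ β / (β.factorial : ℝ)) +
    if h : β < d + 1 then eps ^ (d + 1 - β) * (algebraMap ℝ smoothRing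
      (p ^ (d + 1) / ((d + 1).factorial : ℝ)) * c ⟨β, h⟩)
      + eps ^ (d + 2 - β) * (algebraMap ℝ smoothRing (p ^ (d + 2)) * s ⟨β, h⟩) else 0, ?_, ?_, ?_⟩
  · intro β
    rw [add_sub_cancel_left]
    split_ifs with h
    · have h2 : ∀ k, 2 ≤ k → eps ^ k ∈ Ideal.span {eps ^ 2} := fun k hk =>
        Ideal.mem_span_singleton.2 (pow_dvd_pow _ hk)
      refine Ideal.add_mem _ ?_ (Ideal.mul_mem_right _ _ (h2 _ (by omega)))
      -- The only index at which the term of order `d + 1` retains a single power of `ε`; there its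
      -- coefficient is zero.
      by_cases hβ : β = d
      · subst hβ
        have : c ⟨β, h⟩ = 0 := hclast
        rw [this, mul_zero, mul_zero]
        exact Ideal.zero_mem _
      · exact Ideal.mul_mem_right _ _ (h2 _ (by omega))
    · exact Ideal.zero_mem _
  · intro β hβ
    beta_reduce
    rw [dif_neg (by omega), add_zero]
  · intro ε x β
    have hvec : Γ (x + p * ε) = ∑ k ∈ Finset.range (d + 2),
        ((p * ε) ^ k / (k.factorial : ℝ)) • iteratedDeriv k Γ x
        + (p * ε) ^ (d + 2) • fun i => ρ i (p * ε, x) := by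
      funext i
      have := htay i (p * ε) x
      rw [this]
      simp only [Pi.add_apply, Finset.sum_apply, Pi.smul_apply, smul_eq_mul]
      congr 1
      exact Finset.sum_congr rfl fun k _ => by rw [iteratedDeriv_apply_fin hΓ]
    rw [hvec, Finset.sum_range_succ, Finset.sum_range, frameCoord_add, frameCoord_add,
      frameCoord_sum (hW x), frameCoord_smul, frameCoord_smul]
    have hβ := β.2
    beta_reduce
    rw [dif_pos hβ]
    simp only [map_add, map_mul, map_pow, ev_eps, ev_algebraMap, Pi.add_apply, Pi.smul_apply,
      smul_eq_mul]
    have ec : ev (ε, x) (c β) = frameCoord Γ x (iteratedDeriv (d + 1) Γ x) β := rfl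
    have es : ev (ε, x) (s β) = frameCoord Γ x (fun i => ρ i (p * ε, x)) β := rfl
    rw [Fin.eta, ec, es]
    have e1 : ε ^ (d + 1) = ε ^ (β : ℕ) * ε ^ (d + 1 - (β : ℕ)) := by
      rw [← pow_add]; congr 1; omega
    have e2 : ε ^ (d + 2) = ε ^ (β : ℕ) * ε ^ (d + 2 - (β : ℕ)) := by
      rw [← pow_add]; congr 1; omega
    rw [mul_pow, mul_pow, mul_pow, e1, e2]
    ring

theorem ev_zero_of_sub_mem {f : smoothRing} {c : ℝ}
    (h : f - algebraMap ℝ smoothRing c ∈ Ideal.span {eps ^ 2}) (x : ℝ) : ev (0, x) f = c := by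
  obtain ⟨g, hg⟩ := Ideal.mem_span_singleton'.1 h
  have := congrArg (ev (0, x)) hg
  rw [map_mul, map_pow, map_sub, ev_eps, ev_algebraMap] at this
  simp at this
  linarith

namespace ChiConfig

variable (χ : ChiConfig d)

/-- The product of the top minors of the spanning vectors. -/
def topMinors {R : Type*} [CommRing R] (V : (i : Fin χ.r) → Fin (χ.q i + 1) → ℕ → R) : R :=
  ∏ i, (Matrix.of fun a k : Fin (χ.q i + 1) => V i k a).det

theorem topMinors_map {R R' : Type*} [CommRing R] [CommRing R'] (f : R →+* R')
    (V : (i : Fin χ.r) → Fin (χ.q i + 1) → ℕ → R) :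
    χ.topMinors (fun i k β => f (V i k β)) = f (χ.topMinors V) := by
  rw [topMinors, topMinors, map_prod]
  refine Finset.prod_congr rfl fun i _ => ?_
  rw [RingHom.map_det]
  rfl

/-- The spanning vectors `v (p_{i,k})`. -/
def leadingVectors : (i : Fin χ.r) → Fin (χ.q i + 1) → ℕ → ℝ :=
  fun i k β => χ.p i k ^ β / (β.factorial : ℝ)

/-- Up to factorials in the rows these minors are Vandermonde determinants of distinct nodes. -/
theorem topMinors_leadingVectors_ne_zero : χ.topMinors χ.leadingVectors ≠ 0 := by
  refine Finset.prod_ne_zero_iff.2 fun i _ => ?_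
  have h : (Matrix.of fun a k : Fin (χ.q i + 1) => χ.leadingVectors i k a)
      = Matrix.of fun a k : Fin (χ.q i + 1) => ((a : ℕ).factorial : ℝ)⁻¹ *
        (Matrix.vandermonde (χ.p i)).transpose a k := by
    ext1 a k
    simp [leadingVectors, Matrix.vandermonde, div_eq_inv_mul]
  rw [h, Matrix.det_mul_column, Matrix.det_transpose]
  refine mul_ne_zero (Finset.prod_ne_zero_iff.2 fun a _ => by positivity) ?_
  exact Matrix.det_vandermonde_ne_zero_iff.2 (χ.p_injective i)

theorem mem_plane_iff {γ : ℝ → Projectivization ℝ (Fin (d + 1) → ℝ)} {Γ : ℝ → Fin (d + 1) → ℝ}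
    (hΓ : IsNormalizedLift γ Γ) (ε : ℝ) (i : Fin χ.r) (x : ℝ) (y : Fin (d + 1) → ℝ) :
    y ∈ χ.plane ε γ i x ↔ ∃ c : Fin (χ.q i + 1) → ℝ, ∑ k, c k • Γ (x + χ.p i k * ε) = y := by
  have : χ.plane ε γ i x = Submodule.span ℝ (Set.range fun k => Γ (x + χ.p i k * ε)) := by
    rw [plane, Submodule.span_range_eq_iSup]
    congr 1
    funext k
    obtain ⟨h0, h1⟩ := hΓ.lift (x + χ.p i k * ε)
    rw [← h1, Projectivization.submodule_mk]
  rw [this, Submodule.mem_span_range_iff_exists_fun]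

/-- The intersection of the planes in the rescaled moving frame. -/
theorem iInf_plane_eq {γ : ℝ → Projectivization ℝ (Fin (d + 1) → ℝ)} {Γ : ℝ → Fin (d + 1) → ℝ}
    (hΓ : IsNormalizedLift γ Γ) {ε x : ℝ} (hε : ε ≠ 0)
    {V : (i : Fin χ.r) → Fin (χ.q i + 1) → ℕ → ℝ}
    (hV : ∀ i k (β : Fin (d + 1)),
      ε ^ (β : ℕ) * V i k β = frameCoord Γ x (Γ (x + χ.p i k * ε)) β)
    (hD : (χ.coplanarityMatrix V).det ≠ 0) (hT : χ.topMinors V ≠ 0) :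
    ⨅ i, χ.plane ε γ i x = Submodule.span ℝ {(χ.coplanarityMatrix V).det • Γ x +
      ∑ l : Fin d, (ε ^ ((l : ℕ) + 1) * χ.cramerVec V l) • iteratedDeriv ((l : ℕ) + 1) Γ x} := by
  have hW := hΓ.wronskian x
  have hpow : ∀ k : ℕ, ε ^ k ≠ 0 := fun k => pow_ne_zero k hε
  ext y
  -- Rescaled frame coordinates of `y`. In these, lying in a plane means being a combination of the
  -- `V i k` in rows `0, …, d`, which the minors detect.
  set z : ℕ → ℝ := fun β => if h : β < d + 1 then frameCoord Γ x y ⟨β, h⟩ / ε ^ β else 0 with hz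
  have hzβ : ∀ β : Fin (d + 1), frameCoord Γ x y β = ε ^ (β : ℕ) * z β := by
    intro β
    simp only [hz]
    rw [dif_pos β.2, mul_div_cancel₀ _ (hpow _)]
  have hinj : ∀ {v w : Fin (d + 1) → ℝ}, frameCoord Γ x v = frameCoord Γ x w → v = w := by
    intro v w h
    rw [← sum_frameCoord hW v, h, sum_frameCoord hW w]
  have hplane : ∀ i, y ∈ χ.plane ε γ i x ↔
      ∃ c : Fin (χ.q i + 1) → ℝ, ∀ β ≤ d, z β = ∑ k, c k * V i k β := by
    intro i
    rw [χ.mem_plane_iff hΓ]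
    refine exists_congr fun c => ?_
    have hco : ∀ β : Fin (d + 1), frameCoord Γ x (∑ k, c k • Γ (x + χ.p i k * ε)) β
        = ε ^ (β : ℕ) * ∑ k, c k * V i k β := by
      intro β
      rw [frameCoord, Matrix.mulVec_sum, Finset.sum_apply, Finset.mul_sum]
      refine Finset.sum_congr rfl fun k _ => ?_
      rw [Matrix.mulVec_smul, Pi.smul_apply, smul_eq_mul]
      change c k * frameCoord Γ x _ β = _
      rw [← hV]
      ring
    constructor
    · intro h β hβ
      have h1 := hco ⟨β, by omega⟩
      rw [h, hzβ] at h1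
      exact mul_left_cancel₀ (hpow _) h1
    · intro h
      apply hinj
      funext β
      rw [hco, hzβ, h β (by omega)]
  have htop : ∀ i, (Matrix.of fun a k : Fin (χ.q i + 1) => V i k a).det ≠ 0 := fun i =>
    Finset.prod_ne_zero_iff.1 hT i (Finset.mem_univ i)
  rw [Submodule.mem_iInf, forall_congr' hplane,
    forall_congr' fun i => exists_combination_iff_minors z (V i) (htop i) (χ.q_le i),
    χ.minors_eq_zero_iff V hD, Submodule.mem_span_singleton]
  refine exists_congr fun t => ?_
  have hvec : ∀ s : ℝ, frameCoord Γ x (s • ((χ.coplanarityMatrix V).det • Γ x +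
      ∑ l : Fin d, (ε ^ ((l : ℕ) + 1) * χ.cramerVec V l) • iteratedDeriv ((l : ℕ) + 1) Γ x))
      = Fin.cons (α := fun _ => ℝ) (s * (χ.coplanarityMatrix V).det)
        (fun l => ε ^ ((l : ℕ) + 1) * (s * χ.cramerVec V l)) := by
    intro s
    rw [← frameCoord_sum hW (Fin.cons (α := fun _ => ℝ) (s * (χ.coplanarityMatrix V).det)
        (fun l => ε ^ ((l : ℕ) + 1) * (s * χ.cramerVec V l))), Fin.sum_univ_succ]
    congr 1
    rw [smul_add, smul_smul, Finset.smul_sum]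
    simp only [Fin.cons_zero, Fin.cons_succ, Fin.val_zero, iteratedDeriv_zero, Fin.val_succ,
      smul_smul]
    congr 1
    refine Finset.sum_congr rfl fun l _ => ?_
    congr 1
    ring
  constructor
  · rintro ⟨h0, hl⟩
    apply hinj
    rw [hvec]
    funext β
    refine Fin.cases ?_ (fun l => ?_) β
    · rw [hzβ, Fin.cons_zero, ← h0]
      simp
    · rw [hzβ, Fin.cons_succ, Fin.val_succ, hl]
  · intro h
    rw [← h] at hzβ
    rw [hvec] at hzβ
    constructor
    · have := hzβ 0
      simpa using this.symm
    · intro l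
      have := hzβ l.succ
      rw [Fin.cons_succ, Fin.val_succ] at this
      exact (mul_left_cancel₀ (hpow _) this).symm

/-- The affine coordinates of the intersection point to leading order. -/
def leadingCoord (l : Fin d) : ℝ :=
  χ.cramerVec χ.leadingVectors l / (χ.coplanarityMatrix χ.leadingVectors).det

/-- The expansion of the pentagram map on normalized lifts. -/
theorem hasExpansion (hd : 2 ≤ d) (hχ : χ.Nondegenerate)
    {γ : ℝ → Projectivization ℝ (Fin (d + 1) → ℝ)} {Γ : ℝ → Fin (d + 1) → ℝ}
    {u : Fin d → ℝ → ℝ} (hΓ : IsNormalizedLift γ Γ) (hγ : HasMonodromy γ)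
    (hL : ∀ x, (laxOp u).act Γ x = 0) :
    χ.HasExpansion γ Γ (opG₁ d (χ.leadingCoord ⟨0, by omega⟩))
      (opG₂ d (χ.leadingCoord ⟨0, by omega⟩) (χ.leadingCoord ⟨1, by omega⟩)
        (u ⟨d - 1, sub_one_lt_of_two_le hd⟩)) := by
  obtain ⟨m, rfl⟩ : ∃ m, d = m + 2 := ⟨d - 2, by omega⟩
  obtain ⟨M, hM, hMx⟩ := exists_monodromy_matrix hΓ hγ
  choose v hv hvd hvc using fun p => exists_rescaled_coord hΓ.smooth hΓ.wronskian hL p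
  set V : (i : Fin χ.r) → Fin (χ.q i + 1) → ℕ → smoothRing := fun i k => v (χ.p i k) with hVdef
  set D₀ := (χ.coplanarityMatrix χ.leadingVectors).det with hD₀
  have hD₀ne : D₀ ≠ 0 := χ.det_coplanarityMatrix_ne_zero hχ
  set D := (χ.coplanarityMatrix V).det with hD
  set ζ := χ.cramerVec V with hζ
  obtain ⟨hDmem, hζmem⟩ := χ.coplanarity_sub_mem (I := Ideal.span {eps ^ 2}) (V := V)
    (V' := fun i k β => algebraMap ℝ smoothRing (χ.leadingVectors i k β))
    (fun i k β => hv _ β)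
  rw [det_coplanarityMatrix_map] at hDmem
  simp only [cramerVec_map] at hζmem
  set a := algebraMap ℝ smoothRing with ha
  have haD : a D₀⁻¹ * a D₀ = 1 := by rw [← map_mul, inv_mul_cancel₀ hD₀ne, map_one]
  -- One Newton step towards `1/D`: as `D = D₀ + O(ε²)`, it gives `fD = 1 + O(ε⁴)`. Unlike `1/D` it
  -- is smooth on the whole plane.
  set f := (2 - a D₀⁻¹ * D) * a D₀⁻¹ with hf
  obtain ⟨μ, hμ⟩ := Ideal.mem_span_singleton'.1 hDmem
  choose ν hν using fun l => Ideal.mem_span_singleton'.1 (hζmem l)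
  have hc0 : f * D = 1 + eps ^ 3 * (-eps * (a D₀⁻¹ * μ) ^ 2) := by
    have h1 : D = a D₀ + μ * eps ^ 2 := by rw [hμ]; ring
    rw [hf, h1]
    linear_combination (1 - a D₀⁻¹ * a D₀ - 2 * a D₀⁻¹ * μ * eps ^ 2) * (haD)
  have hcl : ∀ l, ∃ g, f * ζ l = a (χ.leadingCoord l) + eps ^ 2 * g := by
    intro l
    have h1 : D = a D₀ + μ * eps ^ 2 := by rw [hμ]; ring
    have h2 : ζ l = a (χ.cramerVec χ.leadingVectors l) + ν l * eps ^ 2 := by rw [hν]; ring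
    refine ⟨a D₀⁻¹ * (ν l - a D₀⁻¹ * μ * a (χ.cramerVec χ.leadingVectors l)
      - a D₀⁻¹ * μ * eps ^ 2 * ν l), ?_⟩
    rw [leadingCoord, div_eq_mul_inv, map_mul, hf, h1, h2]
    linear_combination (-a D₀⁻¹ * (a (χ.cramerVec χ.leadingVectors l) + ν l * eps ^ 2)) * haD
  choose g hg using hcl
  set g₀ := -eps * (a D₀⁻¹ * μ) ^ 2 with hg₀
  -- All that is left of the Cramer representative after scaling by `f`, divided by `ε³`: the errors
  -- in the coefficients of `Γ`, `Γ'`, `Γ''`, and all terms from `Γ'''` on.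
  set R : ℝ → ℝ → Fin (m + 2 + 1) → ℝ := fun ε x => ev (ε, x) g₀ • Γ x
    + ev (ε, x) (g 0) • iteratedDeriv 1 Γ x + ev (ε, x) (eps * g 1) • iteratedDeriv 2 Γ x
    + ∑ l : Fin m, ev (ε, x) (eps ^ (l : ℕ) * (f * ζ l.succ.succ)) •
      iteratedDeriv ((l : ℕ) + 3) Γ x with hR
  have hevs : ∀ h : smoothRing, ContDiff ℝ ∞ fun z : ℝ × ℝ => ev (z.1, z.2) h := fun h =>
    mem_smoothRing.1 h.2
  have hΓs : ∀ k, ContDiff ℝ ∞ fun z : ℝ × ℝ => iteratedDeriv k Γ z.2 := fun k =>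
    (hΓ.smooth.iteratedDeriv_infty k).comp contDiff_snd
  have hRs : ContDiff ℝ ∞ fun z : ℝ × ℝ => R z.1 z.2 := by
    refine ContDiff.add (ContDiff.add (ContDiff.add ?_ ?_) ?_) ?_
    · exact (hevs _).smul (hΓ.smooth.comp contDiff_snd)
    · exact (hevs _).smul (hΓs 1)
    · exact (hevs _).smul (hΓs 2)
    · exact ContDiff.sum fun l _ => (hevs _).smul (hΓs _)
  have hG : ∀ ε x, perturbedCurve Γ (χ.leadingCoord ⟨0, by omega⟩) (χ.leadingCoord ⟨1, by omega⟩) R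
      ε x = ev (ε, x) f • (ev (ε, x) D • Γ x + ∑ l : Fin (m + 2),
        (ε ^ ((l : ℕ) + 1) * ev (ε, x) (ζ l)) • iteratedDeriv ((l : ℕ) + 1) Γ x) := by
    intro ε x
    have e0 := congrArg (ev (ε, x)) hc0
    have e1 := congrArg (ev (ε, x)) (hg 0)
    have e2 := congrArg (ev (ε, x)) (hg 1)
    simp only [map_mul, map_add, map_pow, map_one, ev_eps, ha, ev_algebraMap] at e0 e1 e2
    rw [perturbedCurve, hR, Fin.sum_univ_succ, Fin.sum_univ_succ]
    simp only [Fin.val_zero, Fin.val_succ, zero_add, Fin.succ_zero_eq_one, Fin.val_one, smul_add,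
      Finset.smul_sum, smul_smul, map_mul, map_pow, ev_eps]
    rw [e0, show ev (ε, x) f * (ε ^ 1 * ev (ε, x) (ζ 0))
        = ε * χ.leadingCoord 0 + ε ^ 3 * ev (ε, x) (g 0) by linear_combination ε * e1,
      show ev (ε, x) f * (ε ^ (1 + 1) * ev (ε, x) (ζ 1))
        = ε ^ 2 * χ.leadingCoord 1 + ε ^ 3 * (ε * ev (ε, x) (g 1)) by linear_combination ε ^ 2 * e2]
    have es : ∀ l : Fin m, (ev (ε, x) f * (ε ^ ((l : ℕ) + 1 + 1 + 1) * ev (ε, x) (ζ l.succ.succ)))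
        • iteratedDeriv ((l : ℕ) + 1 + 1 + 1) Γ x
        = (ε ^ 3 * (ε ^ (l : ℕ) * (ev (ε, x) f * ev (ε, x) (ζ l.succ.succ)))) •
          iteratedDeriv ((l : ℕ) + 3) Γ x := by
      intro l
      congr 1
      ring
    rw [Finset.sum_congr rfl fun l _ => es l]
    simp only [add_smul, one_smul]
    have z0 : (⟨0, by omega⟩ : Fin (m + 2)) = 0 := rfl
    have z1 : (⟨1, by omega⟩ : Fin (m + 2)) = 1 := rfl
    rw [z0, z1]
    abel
  -- For `ε ≠ 0` periodicity follows from that of frame coordinates after cancelling `ε^β`. At `ε =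
  -- 0` and for `β > d` the values are constants.
  have hevV : ∀ ε x, (fun i k β => ev (ε, x + 2 * Real.pi) (V i k β))
      = fun i k β => ev (ε, x) (V i k β) := by
    intro ε x
    funext i k β
    by_cases hβ : β < m + 2 + 1
    · rcases eq_or_ne ε 0 with rfl | hε
      · exact (ev_zero_of_sub_mem (hv _ β) _).trans (ev_zero_of_sub_mem (hv _ β) _).symm
      · refine mul_left_cancel₀ (pow_ne_zero β hε) ?_
        have h1 := hvc (χ.p i k) ε x ⟨β, hβ⟩
        have h2 := hvc (χ.p i k) ε (x + 2 * Real.pi) ⟨β, hβ⟩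
        rw [show x + 2 * Real.pi + χ.p i k * ε = x + χ.p i k * ε + 2 * Real.pi by ring, hMx,
          frameCoord_add_period hΓ.smooth hMx hΓ.wronskian] at h2
        exact h2.trans h1.symm
    · simp only [hVdef, hvd _ β (by omega)]
      rfl
  have hevD : ∀ ε x, ev (ε, x) D
      = (χ.coplanarityMatrix (fun i k β => ev (ε, x) (V i k β))).det := fun ε x =>
    (χ.det_coplanarityMatrix_map V (ev (ε, x))).symm
  have hevζ : ∀ ε x l, ev (ε, x) (ζ l) = χ.cramerVec (fun i k β => ev (ε, x) (V i k β)) l :=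
    fun ε x l => (χ.cramerVec_map V (ev (ε, x)) l).symm
  have hevT : ∀ ε x, ev (ε, x) (χ.topMinors V)
      = χ.topMinors (fun i k β => ev (ε, x) (V i k β)) := fun ε x =>
    (χ.topMinors_map (ev (ε, x)) V).symm
  have hevf : ∀ ε x, ev (ε, x) f = (2 - D₀⁻¹ * ev (ε, x) D) * D₀⁻¹ := by
    intro ε x
    simp only [hf, map_mul, map_sub, map_ofNat, ha, ev_algebraMap]
  have hV0 : ∀ x, (fun i k β => ev (0, x) (V i k β)) = χ.leadingVectors := by
    intro x
    funext i k β
    exact ev_zero_of_sub_mem (hv _ β) x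
  have hcont : ∀ h : smoothRing, Continuous fun z : ℝ × ℝ => ev z h := fun h =>
    (mem_smoothRing.1 h.2).continuous
  -- The three conditions make Cramer's rule valid, the minor criterion applicable and the factor
  -- `f` nonzero.
  obtain ⟨δ, hδ, hball⟩ := exists_forall_mem_of_periodic
    (g := fun z : ℝ × ℝ => (ev z D, ev z (χ.topMinors V)))
    ((hcont _).prodMk (hcont _)) Real.two_pi_pos
    (fun ε x => by rw [hevD, hevD, hevT, hevT, hevV])
    (U := {y : ℝ × ℝ | y.1 ≠ 0 ∧ y.2 ≠ 0 ∧ 2 - D₀⁻¹ * y.1 ≠ 0})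
    ((isOpen_ne.preimage continuous_fst).inter ((isOpen_ne.preimage continuous_snd).inter
      (isOpen_ne.preimage (by fun_prop : Continuous fun y : ℝ × ℝ => 2 - D₀⁻¹ * y.1))))
    (fun x => by
      refine ⟨?_, ?_, ?_⟩
      · simp only [hevD, hV0]
        exact hD₀ne
      · simp only [hevT, hV0]
        exact χ.topMinors_leadingVectors_ne_zero
      · simp only [hevD, hV0]
        rw [← hD₀, inv_mul_cancel₀ hD₀ne]
        norm_num)
  refine χ.hasExpansion_of_perturbedCurve hd hΓ hL _ _ hRs hM (fun ε x => ?_) hδ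
    (fun ε hε x => ?_)
  · rw [hG, hG, Matrix.mulVec_smul, Matrix.mulVec_add, Matrix.mulVec_smul, Matrix.mulVec_sum, hMx,
      hevf, hevf, hevD, hevD, hevV]
    simp only [Matrix.mulVec_smul, iteratedDeriv_add_period hΓ.smooth hMx, hevζ, hevV]
  · obtain ⟨h1, h2, h3⟩ := hball ε (by rw [abs_of_pos hε.1]; exact hε.2) x
    simp only at h1 h2 h3
    rw [χ.iInf_plane_eq hΓ hε.1.ne' (V := fun i k β => ev (ε, x) (V i k β))
      (fun i k β => hvc _ ε x β) (by rw [← hevD]; exact h1) (by rw [← hevT]; exact h2), hG,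
      Submodule.span_singleton_smul_eq (IsUnit.mk0 _ (by
        rw [hevf]
        exact mul_ne_zero h3 (inv_ne_zero hD₀ne)))]
    simp only [hevD, hevζ]

end ChiConfig

end

noncomputable section

/-! ### Comparison of expansions -/

section compare

variable {d : ℕ}

/-- The first order term of an expansion is determined by the curve. -/
theorem ChiConfig.HasExpansion.eq_zero_of_zero {χ : ChiConfig d} (hd : 2 ≤ d)
    {γ : ℝ → Projectivization ℝ (Fin (d + 1) → ℝ)} {Γ : ℝ → Fin (d + 1) → ℝ} {a : ℝ}
    {G G' : DiffOp d} (hΓ : IsNormalizedLift γ Γ) (h : χ.HasExpansion γ Γ (opG₁ d a) G)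
    (h' : χ.HasExpansion γ Γ (0 : DiffOp d) G') : a = 0 := by
  obtain ⟨ε₁, hε₁, Γ₁, him₁, hex₁⟩ := h
  obtain ⟨ε₂, hε₂, Γ₂, him₂, hex₂⟩ := h'
  obtain ⟨C₁, hC₁⟩ := hex₁ {0} isCompact_singleton
  obtain ⟨C₂, hC₂⟩ := hex₂ {0} isCompact_singleton
  by_contra ha
  set v := Γ 0 with hv
  set v₁ := iteratedDeriv 1 Γ 0 with hv₁
  set g := G.act Γ 0 with hg
  set g' := G'.act Γ 0 with hg'
  have hW := hΓ.wronskian 0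
  have hv0 : v ≠ 0 := ne_zero_of_curveWronskian_ne_zero (by rw [hW]; exact one_ne_zero)
  have hv10 : v₁ ≠ 0 := by
    intro h0
    have := Matrix.det_eq_zero_of_column_eq_zero (A := curveFrame Γ 0) ⟨1, by omega⟩ (fun i =>
      congrFun h0 i)
    rw [det_curveFrame, hW] at this
    exact one_ne_zero this
  set B := |a| * ‖v₁‖ + ‖g‖ + ‖g'‖ + |C₁| + |C₂| with hB
  have hB0 : 0 ≤ B := by positivity
  -- The two normalized lifts differ by a sign. Equal signs would give `|a| ‖Γ'‖ ≤ εB`, opposite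
  -- signs `2‖Γ‖ ≤ εB`; an `ε` below both thresholds excludes each.
  have hpos : 0 < min (|a| * ‖v₁‖) (2 * ‖v‖) :=
    lt_min (mul_pos (abs_pos.2 ha) (norm_pos_iff.2 hv10)) (mul_pos two_pos (norm_pos_iff.2 hv0))
  obtain ⟨ε, hε0, hε⟩ : ∃ ε, 0 < ε ∧
      ε < min (min ε₁ ε₂) (min 1 (min (|a| * ‖v₁‖) (2 * ‖v‖) / (B + 1))) :=
    exists_between (lt_min (lt_min hε₁ hε₂) (lt_min one_pos (div_pos hpos (by linarith))))
  have l1 : ε < ε₁ := hε.trans_le ((min_le_left _ _).trans (min_le_left _ _))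
  have l2 : ε < ε₂ := hε.trans_le ((min_le_left _ _).trans (min_le_right _ _))
  have l3 : ε < 1 := hε.trans_le ((min_le_right _ _).trans (min_le_left _ _))
  have l4 : ε * (B + 1) < min (|a| * ‖v₁‖) (2 * ‖v‖) := by
    rw [← lt_div_iff₀ (by linarith)]
    exact hε.trans_le ((min_le_right _ _).trans (min_le_right _ _))
  obtain ⟨η₁, hη₁, hn₁⟩ := him₁ ε ⟨hε0, l1⟩
  obtain ⟨η₂, hη₂, hn₂⟩ := him₂ ε ⟨hε0, l2⟩
  have hη : ∀ x, η₁ x = η₂ x := fun x =>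
    Projectivization.submodule_injective ((hη₁ x).trans (hη₂ x).symm)
  obtain ⟨c, hc, hcx⟩ := exists_const_ratio hn₁.smooth hn₂.smooth one_ne_zero one_ne_zero
    hn₁.wronskian hn₂.wronskian (fun x => by
      obtain ⟨h1, h2⟩ := hn₁.lift x
      obtain ⟨h3, h4⟩ := hn₂.lift x
      have := hη x
      rw [← h2, ← h4, eq_comm, Projectivization.mk_eq_mk_iff'] at this
      obtain ⟨k, hk⟩ := this
      exact ⟨k, hk.symm⟩)
  have hb1 := hC₁ ε ⟨hε0, l1⟩ 0 rfl
  have hb2 := hC₂ ε ⟨hε0, l2⟩ 0 rfl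
  have h0act : (0 : DiffOp d).act Γ 0 = 0 := by simp [DiffOp.act]
  rw [opG₁_act hd] at hb1
  rw [h0act, smul_zero, add_zero] at hb2
  set e₁ := Γ₁ ε 0 - (v + ε • a • v₁ + ε ^ 2 • g) with he₁
  set e₂ := Γ₂ ε 0 - (v + ε ^ 2 • g') with he₂
  have hε3 : ε ^ 3 ≤ ε ^ 2 := pow_le_pow_of_le_one hε0.le l3.le (by norm_num)
  have hε2 : ε ^ 2 ≤ ε := by nlinarith
  have n1 : ‖e₁‖ ≤ ε ^ 2 * |C₁| := hb1.trans (by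
    calc C₁ * ε ^ 3 ≤ |C₁| * ε ^ 2 := by gcongr; exact le_abs_self _
      _ = ε ^ 2 * |C₁| := mul_comm _ _)
  have n2 : ‖e₂‖ ≤ ε ^ 2 * |C₂| := hb2.trans (by
    calc C₂ * ε ^ 3 ≤ |C₂| * ε ^ 2 := by gcongr; exact le_abs_self _
      _ = ε ^ 2 * |C₂| := mul_comm _ _)
  have n3 : ∀ w : Fin (d + 1) → ℝ, ‖ε ^ 2 • w‖ ≤ ε ^ 2 * ‖w‖ := fun w => by
    rw [norm_smul, Real.norm_eq_abs, abs_of_pos (by positivity)]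
  have n4 : ‖ε • a • v₁‖ = ε * (|a| * ‖v₁‖) := by
    rw [norm_smul, norm_smul, Real.norm_eq_abs, Real.norm_eq_abs, abs_of_pos hε0]
  have hav : 0 ≤ |a| * ‖v₁‖ := by positivity
  have hB1 : ε * B ≤ ε * (B + 1) := by nlinarith
  rw [mul_one] at hc
  -- The ratio of two normalized lifts of one curve is a real constant with `c^(d+1) = 1`.
  have hc1 : c = 1 ∨ c = -1 := by
    have : |c| ^ (d + 1) = 1 := by rw [← abs_pow, hc, abs_one]
    have := (pow_eq_one_iff_of_nonneg (abs_nonneg c) (by omega)).1 this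
    exact eq_or_eq_neg_of_abs_eq this
  rcases hc1 with rfl | rfl
  · have hk : ε • a • v₁ = ε ^ 2 • g' - ε ^ 2 • g + e₂ - e₁ := by
      have := hcx 0
      rw [one_smul] at this
      rw [he₁, he₂, this]
      abel
    have hle : ε * (|a| * ‖v₁‖) ≤ ε * (ε * B) := by
      rw [← n4, hk]
      calc _ ≤ ‖ε ^ 2 • g'‖ + ‖ε ^ 2 • g‖ + ‖e₂‖ + ‖e₁‖ := by
            refine (norm_sub_le _ _).trans (add_le_add_left ?_ _)
            refine (norm_add_le _ _).trans (add_le_add_left ?_ _)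
            exact norm_sub_le _ _
        _ ≤ ε ^ 2 * ‖g'‖ + ε ^ 2 * ‖g‖ + ε ^ 2 * |C₂| + ε ^ 2 * |C₁| := by
            gcongr
            · exact n3 _
            · exact n3 _
        _ ≤ ε ^ 2 * (|a| * ‖v₁‖) + (ε ^ 2 * ‖g'‖ + ε ^ 2 * ‖g‖ + ε ^ 2 * |C₂| + ε ^ 2 * |C₁|) :=
            le_add_of_nonneg_left (by positivity)
        _ = _ := by rw [hB]; ring
    have h5 := le_of_mul_le_mul_left hle hε0
    have := l4.trans_le (min_le_left _ _)
    linarith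
  · have hk : (2 : ℝ) • v = -(ε • a • v₁ + ε ^ 2 • g + ε ^ 2 • g' + e₁ + e₂) := by
      have := hcx 0
      rw [neg_one_smul] at this
      rw [he₁, he₂, this, two_smul]
      abel
    have hle : 2 * ‖v‖ ≤ ε * B := by
      have h2 : ‖(2 : ℝ) • v‖ = 2 * ‖v‖ := by rw [norm_smul]; norm_num
      rw [← h2, hk, norm_neg]
      calc _ ≤ ‖ε • a • v₁‖ + ‖ε ^ 2 • g‖ + ‖ε ^ 2 • g'‖ + ‖e₁‖ + ‖e₂‖ := by
            refine (norm_add_le _ _).trans (add_le_add_left ?_ _)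
            refine (norm_add_le _ _).trans (add_le_add_left ?_ _)
            refine (norm_add_le _ _).trans (add_le_add_left ?_ _)
            exact norm_add_le _ _
        _ ≤ ε * (|a| * ‖v₁‖) + ε ^ 2 * ‖g‖ + ε ^ 2 * ‖g'‖ + ε ^ 2 * |C₁| + ε ^ 2 * |C₂| := by
            gcongr
            · exact n4.le
            · exact n3 _
            · exact n3 _
        _ ≤ ε * (|a| * ‖v₁‖) + ε * ‖g‖ + ε * ‖g'‖ + ε * |C₁| + ε * |C₂| := by gcongr
        _ = _ := by rw [hB]; ring
    have := l4.trans_le (min_le_right _ _)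
    linarith

end compare

/-! ### Roots in the algebra of formal pseudodifferential operators -/

namespace PsiDO

theorem npow_order {A : PsiDO} (hA : A.order = 1) (m : ℕ) : (A.npow m).order = m := by
  induction m with
  | zero => rfl
  | succ m ih =>
    change (A.npow m).order + A.order = _
    rw [ih, hA]
    push_cast
    rfl

theorem npow_succ_coeff (A : PsiDO) (m n : ℕ) (x : ℝ) : (A.npow (m + 1)).coeff n x =
    ∑ a ∈ Finset.HasAntidiagonal.antidiagonal n, ∑ b ∈ Finset.HasAntidiagonal.antidiagonal a.2,
    ((Ring.choose ((A.npow m).order - (a.1 : ℤ)) b.1 : ℤ) : ℝ) * (A.npow m).coeff a.1 x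
      * iteratedDeriv b.1 (A.coeff b.2) x := rfl

theorem npow_coeff_zero {A : PsiDO} (h0 : A.coeff 0 = fun _ => 1) (m : ℕ) :
    (A.npow m).coeff 0 = fun _ => 1 := by
  induction m with
  | zero => rfl
  | succ m ih =>
    funext x
    rw [npow_succ_coeff]
    simp [ih, h0]

/-- How the coefficients of powers depend on those of the operator. -/
theorem npow_coeff_sub {A B : PsiDO} (hA : A.order = 1) (hB : B.order = 1)
    (hA0 : A.coeff 0 = fun _ => 1) {n : ℕ}
    (h : ∀ k ≤ n, A.coeff k = B.coeff k) (m : ℕ) :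
    (∀ k ≤ n, (A.npow m).coeff k = (B.npow m).coeff k) ∧
      ∀ x, (A.npow m).coeff (n + 1) x - (B.npow m).coeff (n + 1) x
        = m * (A.coeff (n + 1) x - B.coeff (n + 1) x) := by
  have hB0 : B.coeff 0 = fun _ => 1 := by rw [← h 0 (Nat.zero_le _), hA0]
  induction m with
  | zero => exact ⟨fun _ _ => rfl, fun x => by simp [npow]⟩
  | succ m ih =>
    constructor
    · intro k hk
      funext x
      rw [npow_succ_coeff, npow_succ_coeff, npow_order hA, npow_order hB]
      refine Finset.sum_congr rfl fun a ha => Finset.sum_congr rfl fun b hb => ?_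
      rw [Finset.HasAntidiagonal.mem_antidiagonal] at ha hb
      rw [ih.1 a.1 (by omega), h b.2 (by omega)]
    · intro x
      rw [npow_succ_coeff, npow_succ_coeff, npow_order hA, npow_order hB, ← Finset.sum_sub_distrib]
      -- The coefficients of index `n + 1` enter the product only in the two extreme terms, each
      -- multiplied by a leading coefficient one. Every other term uses coefficients of index at
      -- most `n`, which coincide.
      have hterm : ∀ a ∈ Finset.HasAntidiagonal.antidiagonal (n + 1),
          (∑ b ∈ Finset.HasAntidiagonal.antidiagonal a.2,
            ((Ring.choose ((m : ℤ) - (a.1 : ℤ)) b.1 : ℤ) : ℝ) * (A.npow m).coeff a.1 x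
              * iteratedDeriv b.1 (A.coeff b.2) x) -
          (∑ b ∈ Finset.HasAntidiagonal.antidiagonal a.2,
            ((Ring.choose ((m : ℤ) - (a.1 : ℤ)) b.1 : ℤ) : ℝ) * (B.npow m).coeff a.1 x
              * iteratedDeriv b.1 (B.coeff b.2) x)
          = (if a = (n + 1, 0) then (A.npow m).coeff (n + 1) x - (B.npow m).coeff (n + 1) x else 0)
            + if a = (0, n + 1) then A.coeff (n + 1) x - B.coeff (n + 1) x else 0 := by
        rintro ⟨i, j⟩ ha
        rw [Finset.HasAntidiagonal.mem_antidiagonal] at ha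
        simp only at ha
        by_cases hi : i = n + 1
        · obtain rfl : j = 0 := by omega
          subst hi
          simp [hA0, hB0]
        · rw [if_neg (by simp [hi]), zero_add, ih.1 i (by omega), ← Finset.sum_sub_distrib]
          by_cases hi0 : i = 0
          · subst hi0
            obtain rfl : j = n + 1 := by omega
            rw [if_pos rfl, Finset.sum_eq_single (0, n + 1)]
            · simp [npow_coeff_zero hB0]
            · rintro ⟨b, c⟩ hb hne
              rw [Finset.HasAntidiagonal.mem_antidiagonal] at hb
              simp only at hb
              have : c ≤ n := by
                by_contra hcn
                exact hne (Prod.ext (by simp only; omega) (by simp only; omega))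
              rw [h c this, sub_self]
            · simp
          · rw [if_neg (by simp [hi0])]
            refine Finset.sum_eq_zero fun b hb => ?_
            rw [Finset.HasAntidiagonal.mem_antidiagonal] at hb
            simp only at hb
            rw [h b.2 (by omega), sub_self]
      rw [Finset.sum_congr rfl hterm, Finset.sum_add_distrib, Finset.sum_ite_eq', Finset.sum_ite_eq',
        if_pos (by simp), if_pos (by simp), ih.2]
      push_cast
      ring

/-- The operator `∂`. -/
def deriv : PsiDO := ⟨1, fun k _ => if k = 0 then 1 else 0⟩

theorem deriv_npow_coeff (m : ℕ) : ∀ k ≠ 0, ∀ x, (deriv.npow m).coeff k x = 0 := by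
  induction m with
  | zero => intro k hk x; simp [npow, hk]
  | succ m ih =>
    intro k hk x
    rw [npow_succ_coeff]
    refine Finset.sum_eq_zero fun a ha => Finset.sum_eq_zero fun b hb => ?_
    rw [Finset.HasAntidiagonal.mem_antidiagonal] at ha hb
    by_cases h1 : a.1 = 0
    · have : iteratedDeriv b.1 (deriv.coeff b.2) x = 0 := by
        simp only [deriv]
        rw [iteratedDeriv_const]
        split_ifs <;> first | rfl | omega
      rw [this, mul_zero]
    · rw [ih _ h1, mul_zero, zero_mul]

/-- The first two coefficients of the powers of `∂ + b ∂⁻¹ + ⋯`. -/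
theorem npow_coeff_one_eq {A : PsiDO} (hA : A.order = 1) (hA0 : A.coeff 0 = fun _ => 1) (m : ℕ)
    (x : ℝ) : (A.npow m).coeff 1 x = m * A.coeff 1 x := by
  have := (npow_coeff_sub (B := deriv) (n := 0) hA rfl hA0 (fun k hk => by
    obtain rfl : k = 0 := by omega
    rw [hA0]
    rfl) m).2 x
  rw [deriv_npow_coeff m _ (by simp)] at this
  simpa [deriv] using this

/-- Comparison with `∂`, which has the same coefficients of index `0` and `1` and whose powers have
no lower terms. -/
theorem npow_coeff_two_eq {A : PsiDO} (hA : A.order = 1) (hA0 : A.coeff 0 = fun _ => 1)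
    (hA1 : A.coeff 1 = fun _ => 0) (m : ℕ) (x : ℝ) : (A.npow m).coeff 2 x = m * A.coeff 2 x := by
  have := (npow_coeff_sub (B := deriv) (n := 1) hA rfl hA0 (fun k hk => by
    obtain rfl | rfl : k = 0 ∨ k = 1 := by omega
    · rw [hA0]
      rfl
    · rw [hA1]
      rfl) m).2 x
  rw [deriv_npow_coeff m _ (by simp)] at this
  simpa [deriv] using this

/-- Smooth periodic coefficients. -/
def IsNice (T : ℝ) (A : PsiDO) : Prop :=
  ∀ k, ContDiff ℝ ∞ (A.coeff k) ∧ Function.Periodic (A.coeff k) T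

theorem IsNice.npow {T : ℝ} {A : PsiDO} (hA : A.IsNice T) (m : ℕ) : (A.npow m).IsNice T := by
  induction m with
  | zero => exact fun k => ⟨contDiff_const, fun x => rfl⟩
  | succ m ih =>
    intro k
    have e : (A.npow (m + 1)).coeff k = fun x => _ := funext fun x => npow_succ_coeff A m k x
    constructor
    · rw [e]
      refine ContDiff.sum fun a _ => ContDiff.sum fun b _ => ?_
      exact (contDiff_const.mul (ih _).1).mul ((hA _).1.iteratedDeriv_infty _)
    · intro x
      rw [npow_succ_coeff, npow_succ_coeff]
      refine Finset.sum_congr rfl fun a _ => Finset.sum_congr rfl fun b _ => ?_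
      rw [(ih _).2 x]
      congr 1
      have := congrFun (iteratedDeriv_comp_add_const b.1 (A.coeff b.2) T) x
      rw [← this, funext (hA b.2).2]

/-- Successive approximations to the `N`-th root of the operator with coefficients `t`. -/
def rootApprox (N : ℕ) (t : ℕ → ℝ → ℝ) : ℕ → ℕ → ℝ → ℝ
  | 0 => deriv.coeff
  | n + 1 => Function.update (rootApprox N t n) (n + 1) fun x =>
      (t (n + 1) x - ((⟨1, rootApprox N t n⟩ : PsiDO).npow N).coeff (n + 1) x) / N

/-- The `N`-th root of the operator of order `N` with coefficients `t`. -/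
def root (N : ℕ) (t : ℕ → ℝ → ℝ) : PsiDO := ⟨1, fun k => rootApprox N t k k⟩

section root

variable (N : ℕ) (t : ℕ → ℝ → ℝ)

theorem rootApprox_of_lt (n k : ℕ) (h : n < k) : rootApprox N t n k = fun _ => 0 := by
  induction n with
  | zero => funext x; simp [rootApprox, deriv]; omega
  | succ n ih => rw [rootApprox, Function.update_of_ne (by omega), ih (by omega)]

theorem rootApprox_of_le (n k : ℕ) (h : k ≤ n) : rootApprox N t n k = rootApprox N t k k := by
  induction n with
  | zero => rw [Nat.le_zero.1 h]
  | succ n ih =>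
    rcases Nat.lt_or_eq_of_le h with h | rfl
    · rw [rootApprox, Function.update_of_ne (by omega), ih (by omega)]
    · rfl

/-- By `npow_coeff_sub`, changing coefficient `n + 1` of the root changes that coefficient of the
`N`-th power by `N` times as much. The update in `rootApprox` therefore corrects it exactly, and
later updates leave it alone. -/
theorem root_npow (hN : N ≠ 0) (h0 : t 0 = fun _ => 1) (k : ℕ) :
    ((root N t).npow N).coeff k = t k := by
  have hr0 : (root N t).coeff 0 = fun _ => 1 := by
    funext x
    simp [root, rootApprox, deriv]
  rcases k with _ | n
  · rw [npow_coeff_zero hr0, h0]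
  · funext x
    have h1 := (npow_coeff_sub (A := root N t) (B := ⟨1, rootApprox N t n⟩) (n := n) rfl rfl hr0
      (fun k hk => (rootApprox_of_le N t n k hk).symm) N).2 x
    have h2 : (root N t).coeff (n + 1) x = (t (n + 1) x
        - ((⟨1, rootApprox N t n⟩ : PsiDO).npow N).coeff (n + 1) x) / N := by
      simp [root, rootApprox]
    have h3 : (⟨1, rootApprox N t n⟩ : PsiDO).coeff (n + 1) x = 0 :=
      congrFun (rootApprox_of_lt N t n (n + 1) (by omega)) x
    rw [h2, h3, sub_zero,
      mul_div_cancel₀ _ (Nat.cast_ne_zero.2 hN)] at h1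
    linarith

theorem root_isNice {T : ℝ} (ht : ∀ k, ContDiff ℝ ∞ (t k) ∧ Function.Periodic (t k) T) :
    (root N t).IsNice T := by
  have h : ∀ n, (⟨1, rootApprox N t n⟩ : PsiDO).IsNice T := by
    intro n
    induction n with
    | zero => exact fun k => ⟨contDiff_const, fun x => rfl⟩
    | succ n ih =>
      intro k
      simp only [rootApprox]
      rcases eq_or_ne k (n + 1) with rfl | hk
      · simp only [Function.update_self]
        have h1 := ih.npow N (n + 1)
        refine ⟨((ht _).1.sub h1.1).div_const _, fun x => ?_⟩
        simp only
        rw [(ht _).2 x, h1.2 x]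
      · simp only [Function.update_of_ne hk]
        exact ih k
  exact fun k => h k k

end root

end PsiDO

section laxRoot

variable {d : ℕ}

/-- Existence of the root `L^(1/(d+1))` and the differential part of its square. -/
theorem exists_isLaxRoot (hd : 2 ≤ d) {u : Fin d → ℝ → ℝ} (hu : ∀ i, ContDiff ℝ ∞ (u i))
    (hp : ∀ i, Function.Periodic (u i) (2 * Real.pi)) :
    ∃ R : PsiDO, IsLaxRoot u R ∧ ∀ (f : ℝ → ℝ) (x : ℝ), ((R.npow 2).diffPart 2).act f x
      = iteratedDeriv 2 f x + 2 / ((d : ℝ) + 1) * u ⟨d - 1, sub_one_lt_of_two_le hd⟩ x * f x := by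
  set t := (laxOp u).toPsiDO.coeff with ht
  have htc : ∀ k x, t k x = if k ≤ d + 1 then laxOp u ⟨d + 1 - k, by omega⟩ x else 0 :=
    fun k x => rfl
  have ht0 : t 0 = fun _ => 1 := by
    funext x
    simp [htc, laxOp]
  have ht1 : t 1 = fun _ => 0 := by
    funext x
    simp [htc, laxOp]
  have ht2 : t 2 = u ⟨d - 1, sub_one_lt_of_two_le hd⟩ := by
    funext x
    rw [htc, if_pos (by omega), laxOp]
    simp only
    rw [dif_pos (by omega)]
    congr 2
  have hnice : ∀ k, ContDiff ℝ ∞ (t k) ∧ Function.Periodic (t k) (2 * Real.pi) := by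
    intro k
    by_cases hk : k ≤ d + 1 ∧ d + 1 - k < d
    · have : t k = u ⟨d + 1 - k, hk.2⟩ := by
        funext x
        rw [htc, if_pos hk.1, laxOp]
        simp only
        rw [dif_pos hk.2]
      rw [this]
      exact ⟨hu _, hp _⟩
    · have : ∃ c : ℝ, t k = fun _ => c := by
        by_cases h1 : k ≤ d + 1
        · refine ⟨if d + 1 - k = d + 1 then 1 else 0, ?_⟩
          funext x
          rw [htc, if_pos h1, laxOp]
          simp only
          rw [dif_neg (fun h => hk ⟨h1, h⟩)]
        · exact ⟨0, funext fun x => by rw [htc, if_neg h1]⟩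
      obtain ⟨c, hc⟩ := this
      rw [hc]
      exact ⟨contDiff_const, fun _ => rfl⟩
  set R := PsiDO.root (d + 1) t with hR
  have hRo : R.order = 1 := rfl
  have hpow := PsiDO.root_npow (d + 1) t (by omega) ht0
  have hR0 : R.coeff 0 = fun _ => 1 := by
    funext x
    simp [hR, PsiDO.root, PsiDO.rootApprox, PsiDO.deriv]
  have hd1 : ((d : ℝ) + 1) ≠ 0 := by positivity
  -- The absence of a `∂^d` term in `L` forces the order zero coefficient of the root to vanish.
  have hR1 : R.coeff 1 = fun _ => 0 := by
    funext x
    have h1 := PsiDO.npow_coeff_one_eq hRo hR0 (d + 1) x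
    rw [hpow 1, ht1] at h1
    push_cast at h1
    exact (mul_eq_zero.1 h1.symm).resolve_left hd1
  have hR2 : ∀ x, R.coeff 2 x = u ⟨d - 1, sub_one_lt_of_two_le hd⟩ x / ((d : ℝ) + 1) := by
    intro x
    have h1 := PsiDO.npow_coeff_two_eq hRo hR0 hR1 (d + 1) x
    rw [hpow 2, ht2] at h1
    push_cast at h1
    rw [h1]
    field_simp
  have hRn := PsiDO.root_isNice (d + 1) t hnice
  refine ⟨R, ⟨hRo, hR0, hR1, fun k => (hRn k).1, fun k => (hRn k).2, ?_⟩, fun f x => ?_⟩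
  · refine PsiDO.ext (PsiDO.npow_order hRo _) (funext hpow)
  · have ho : (R.npow 2).order = 2 := PsiDO.npow_order hRo 2
    have c0 := congrFun (PsiDO.npow_coeff_zero hR0 2) x
    have c1 := PsiDO.npow_coeff_one_eq hRo hR0 2 x
    have c2 := PsiDO.npow_coeff_two_eq hRo hR0 hR1 2 x
    rw [hR1] at c1
    rw [hR2] at c2
    rw [DiffOp.act, Fin.sum_univ_three]
    simp only [PsiDO.diffPart, ho]
    norm_num [c0, c1, c2, show Int.toNat 2 = 2 from rfl]
    ring

end laxRoot

end

/-! ### The Lax equation of the flow -/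

noncomputable section

variable {d : ℕ}

theorem laxOp_act_add {u : Fin d → ℝ → ℝ} {f g : ℝ → ℝ} (hf : ContDiff ℝ ∞ f)
    (hg : ContDiff ℝ ∞ g) (x : ℝ) :
    (laxOp u).act (fun y => f y + g y) x = (laxOp u).act f x + (laxOp u).act g x := by
  simp only [DiffOp.act]
  rw [← Finset.sum_add_distrib]
  refine Finset.sum_congr rfl fun j _ => ?_
  rw [iteratedDeriv_fun_add (hf.contDiffAt.of_le (by exact_mod_cast le_top))
    (hg.contDiffAt.of_le (by exact_mod_cast le_top)), smul_add]

theorem contDiff_laxOp_act {u : Fin d → ℝ → ℝ} (hu : ∀ i, ContDiff ℝ ∞ (u i)) {f : ℝ → ℝ}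
    (hf : ContDiff ℝ ∞ f) : ContDiff ℝ ∞ ((laxOp u).act f) := by
  rw [show (laxOp u).act f = _ from funext fun x => laxOp_act u f x]
  exact (hf.iteratedDeriv_infty _).add
    (ContDiff.sum fun i _ => (hu i).smul (hf.iteratedDeriv_infty _))

/-- The operator `∂² + q`. -/
def schrodinger (q : ℝ → ℝ) (f : ℝ → ℝ) (x : ℝ) : ℝ := iteratedDeriv 2 f x + q x * f x

theorem contDiff_schrodinger {q f : ℝ → ℝ} (hq : ContDiff ℝ ∞ q) (hf : ContDiff ℝ ∞ f) :
    ContDiff ℝ ∞ (schrodinger q f) := (hf.iteratedDeriv_infty 2).add (hq.mul hf)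

theorem schrodinger_add {q f g : ℝ → ℝ} (hf : ContDiff ℝ ∞ f) (hg : ContDiff ℝ ∞ g) (x : ℝ) :
    schrodinger q (fun y => f y + g y) x = schrodinger q f x + schrodinger q g x := by
  simp only [schrodinger]
  rw [iteratedDeriv_fun_add (hf.contDiffAt.of_le (WithTop.coe_le_coe.2 le_top))
    (hg.contDiffAt.of_le (WithTop.coe_le_coe.2 le_top))]
  ring

section jets

variable {g p : ℝ → ℝ} {x : ℝ}

theorem iteratedDeriv_mul_of_jet_eq_zero (hg : ContDiff ℝ ∞ g) (hp : ContDiff ℝ ∞ p)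
    {k : ℕ} (h : ∀ j < k, iteratedDeriv j g x = 0) :
    iteratedDeriv k (fun y => p y * g y) x = p x * iteratedDeriv k g x := by
  rw [iteratedDeriv_fun_mul (hp.contDiffAt.of_le (by exact_mod_cast le_top))
    (hg.contDiffAt.of_le (by exact_mod_cast le_top)), Finset.sum_range_succ', Finset.sum_eq_zero]
  · simp
  · intro i hi
    rw [Finset.mem_range] at hi
    rw [h _ (by omega), mul_zero]

/-- The commutator of `∂² + q` and `L` has order at most `d`. -/
theorem commutator_eq_zero_of_jet {u : Fin d → ℝ → ℝ} (hu : ∀ i, ContDiff ℝ ∞ (u i))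
    {q : ℝ → ℝ} (hq : ContDiff ℝ ∞ q) (hg : ContDiff ℝ ∞ g)
    (h : ∀ j ≤ d, iteratedDeriv j g x = 0) :
    schrodinger q ((laxOp u).act g) x - (laxOp u).act (schrodinger q g) x = 0 := by
  have c0 : ∀ {n : ℕ} {f : ℝ → ℝ}, ContDiff ℝ ∞ f → ContDiffAt ℝ n f x := fun hf =>
    hf.contDiffAt.of_le (by exact_mod_cast le_top)
  have hgk := fun k => hg.iteratedDeriv_infty k
  have h1 : (laxOp u).act g x = iteratedDeriv (d + 1) g x := by
    rw [laxOp_act, Finset.sum_eq_zero, add_zero]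
    intro i _
    rw [h _ (by omega), smul_zero]
  -- In each product derivatives falling on `u i` multiply derivatives of `g` of order at most `d`,
  -- which vanish at `x`. The same mechanism gives `h3`, so both compositions reduce to the same
  -- terms, `q` contributing only `q g^(d+1)`.
  have h2 : iteratedDeriv 2 ((laxOp u).act g) x = iteratedDeriv (d + 3) g x
      + ∑ i : Fin d, u i x * iteratedDeriv ((i : ℕ) + 2) g x := by
    rw [show (laxOp u).act g = _ from funext fun x => laxOp_act u g x]
    have hsm : ∀ i, ContDiff ℝ ∞ (fun y => u i y • iteratedDeriv (i : ℕ) g y) :=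
      fun i => (hu i).smul (hgk i)
    have hsum : ContDiff ℝ ∞ (fun y => ∑ i : Fin d, u i y • iteratedDeriv (i : ℕ) g y) :=
      ContDiff.sum fun i _ => hsm i
    rw [iteratedDeriv_fun_add (c0 (hgk _)) (c0 hsum),
      iteratedDeriv_fun_sum fun i _ => c0 (hsm i), iteratedDeriv_iteratedDeriv,
      show 2 + (d + 1) = d + 3 by omega]
    congr 1
    refine Finset.sum_congr rfl fun i _ => ?_
    have := iteratedDeriv_mul_of_jet_eq_zero (x := x) (hgk i) (hu i) (k := 2) (fun j hj => by
      rw [iteratedDeriv_iteratedDeriv]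
      exact h _ (by have := i.2; omega))
    rw [iteratedDeriv_iteratedDeriv, add_comm 2] at this
    exact this
  have h3 : ∀ k ≤ d + 1, iteratedDeriv k (schrodinger q g) x
      = iteratedDeriv (k + 2) g x + q x * iteratedDeriv k g x := by
    intro k hk
    change iteratedDeriv k (fun y => iteratedDeriv 2 g y + q y * g y) x = _
    rw [iteratedDeriv_fun_add (c0 (hgk 2)) (c0 (hq.mul hg)), iteratedDeriv_iteratedDeriv,
      iteratedDeriv_mul_of_jet_eq_zero hg hq (fun j hj => h j (by omega))]
  rw [schrodinger, h1, h2, laxOp_act, h3 _ le_rfl]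
  have h4 : ∀ i : Fin d, u i x • iteratedDeriv (i : ℕ) (schrodinger q g) x
      = u i x * iteratedDeriv ((i : ℕ) + 2) g x := by
    intro i
    rw [h3 _ (by omega), h (i : ℕ) (by omega), mul_zero, add_zero, smul_eq_mul]
  rw [Finset.sum_congr rfl fun i _ => h4 i]
  ring

end jets

section flow

variable {I : Set ℝ} {Γ : ℝ → ℝ → Fin (d + 1) → ℝ} {u : ℝ → Fin d → ℝ → ℝ}

/-- The coefficients are frame coordinates of `Γ^(d+1)`, hence jointly smooth in time and position
on `I × ℝ`. -/
theorem differentiableAt_laxOp_coeff (hI : IsOpen I)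
    (hΓ : ContDiffOn ℝ ∞ (fun z : ℝ × ℝ => Γ z.1 z.2) (I ×ˢ Set.univ))
    (hW : ∀ t ∈ I, ∀ x, curveWronskian (Γ t) x = 1)
    (hL : ∀ t ∈ I, ∀ x, (laxOp (u t)).act (Γ t) x = 0) {t : ℝ} (ht : t ∈ I) (i : Fin d) (x : ℝ) :
    DifferentiableAt ℝ (fun s => u s i x) t := by
  have h1 := contDiffOn_pi.1 (contDiffOn_frameCoord hI hΓ
    (contDiffOn_iteratedDeriv_snd hI hΓ (d + 1))) i.castSucc
  have h2 := (hasDerivAt_fst_of_contDiffOn hI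
    (F := fun s y => frameCoord (Γ s) y (iteratedDeriv (d + 1) (Γ s) y) i.castSucc) h1 ht x).neg
  refine h2.differentiableAt.congr_of_eventuallyEq ?_
  filter_upwards [hI.mem_nhds ht] with s hs
  exact laxOp_coeff_eq (hL s hs) (hW s hs) i x

/-- If the normalized lifts evolve by `b (∂² + q)`, their operators satisfy the Lax equation. -/
theorem lax_equation_of_flow (hI : IsOpen I)
    (hΓ : ContDiffOn ℝ ∞ (fun z : ℝ × ℝ => Γ z.1 z.2) (I ×ˢ Set.univ))
    (hs : ∀ t ∈ I, ContDiff ℝ ∞ (Γ t))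
    (hW : ∀ t ∈ I, ∀ x, curveWronskian (Γ t) x = 1)
    (hL : ∀ t ∈ I, ∀ x, (laxOp (u t)).act (Γ t) x = 0) {b t : ℝ} (ht : t ∈ I) {q : ℝ → ℝ}
    (hq : ContDiff ℝ ∞ q)
    (hflow : ∀ x, HasDerivAt (fun s => Γ s x)
      (b • (iteratedDeriv 2 (Γ t) x + q x • Γ t x)) t)
    {f : ℝ → ℝ} (hf : ContDiff ℝ ∞ f) (x : ℝ) :
    ∑ i : Fin d, deriv (fun s => u s i x) t * iteratedDeriv (i : ℕ) f x
      = b * (schrodinger q ((laxOp (u t)).act f) x - (laxOp (u t)).act (schrodinger q f) x) := by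
  have hu : ∀ i, ContDiff ℝ ∞ (u t i) := contDiff_laxOp_coeff (hL t ht) (hs t ht) (hW t ht)
  set D : Fin d → ℝ := fun i => deriv (fun s => u s i x) t with hD
  set X : ℝ → Fin (d + 1) → ℝ := fun y => b • (iteratedDeriv 2 (Γ t) y + q y • Γ t y) with hX
  have hXs : ContDiff ℝ ∞ X :=
    (((hs t ht).iteratedDeriv_infty 2).add (hq.smul (hs t ht))).const_smul b
  have hjet : ∀ k, HasDerivAt (fun s => iteratedDeriv k (Γ s) x) (iteratedDeriv k X x) t := by
    intro k
    have := hasDerivAt_iteratedDeriv_fst hI hΓ ht x k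
    rwa [show (fun y => deriv (fun s => Γ s y) t) = X from funext fun y => (hflow y).deriv] at this
  -- The time derivative of `LΓ = 0` at `x`, using that time and space derivatives commute.
  have hlin : iteratedDeriv (d + 1) X x + ∑ i : Fin d,
      (u t i x • iteratedDeriv (i : ℕ) X x + D i • iteratedDeriv (i : ℕ) (Γ t) x) = 0 := by
    have h1 : HasDerivAt (fun s => iteratedDeriv (d + 1) (Γ s) x
        + ∑ i : Fin d, u s i x • iteratedDeriv (i : ℕ) (Γ s) x) _ t :=
      (hjet (d + 1)).add (HasDerivAt.fun_sum fun i _ =>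
        ((differentiableAt_laxOp_coeff hI hΓ hW hL ht i x).hasDerivAt).smul (hjet i))
    refine h1.unique ((hasDerivAt_const t (0 : Fin (d + 1) → ℝ)).congr_of_eventuallyEq ?_)
    filter_upwards [hI.mem_nhds ht] with s hs
    rw [← laxOp_act, hL s hs]
  have hLX : (laxOp (u t)).act X x = -∑ i : Fin d, D i • iteratedDeriv (i : ℕ) (Γ t) x := by
    rw [laxOp_act, eq_neg_iff_add_eq_zero, add_assoc, ← Finset.sum_add_distrib, hlin]
  -- the osculating combination of the components of `Γ t`
  set φ : (Fin (d + 1) → ℝ) →L[ℝ] ℝ := LinearMap.toContinuousLinearMap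
    (∑ j : Fin (d + 1), iteratedDeriv (j : ℕ) f x •
      ((LinearMap.proj j : (Fin (d + 1) → ℝ) →ₗ[ℝ] ℝ) ∘ₗ
        Matrix.mulVecLin (curveFrame (Γ t) x).adjugate)) with hφ
  have hφa : ∀ w, φ w = ∑ j : Fin (d + 1), iteratedDeriv (j : ℕ) f x * frameCoord (Γ t) x w j := by
    intro w
    simp [hφ, frameCoord]
  have hφj : ∀ j ≤ d, φ (iteratedDeriv j (Γ t) x) = iteratedDeriv j f x := by
    intro j hj
    have := frameCoord_iteratedDeriv (hW t ht x) ⟨j, by omega⟩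
    simp only at this
    rw [hφa, this, Finset.sum_eq_single ⟨j, by omega⟩]
    · simp
    · intro k _ hk
      simp [hk]
    · simp
  set f₁ : ℝ → ℝ := fun y => φ (Γ t y) with hf₁
  have hf₁s : ContDiff ℝ ∞ f₁ := φ.contDiff.comp (hs t ht)
  -- The function `f` splits into `f₁`, a fixed linear functional of `Γ t` annihilated by `L`, and
  -- `g`, whose `d`-jet at `x` is zero. On `f₁` the Lax equation is the differentiated relation; on
  -- `g` both sides vanish at `x`.
  set g : ℝ → ℝ := fun y => f y - f₁ y with hg
  have hgs : ContDiff ℝ ∞ g := hf.sub hf₁s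
  have hfe : f = fun y => f₁ y + g y := by
    funext y
    simp [hg]
  have hf₁k : ∀ k y, iteratedDeriv k f₁ y = φ (iteratedDeriv k (Γ t) y) :=
    fun k y => iteratedDeriv_clm_comp φ (hs t ht) k y
  have hgjet : ∀ j ≤ d, iteratedDeriv j g x = 0 := by
    intro j hj
    have h1 := congrArg (fun F : ℝ → ℝ => iteratedDeriv j F x) hfe
    beta_reduce at h1
    rw [iteratedDeriv_fun_add (hf₁s.contDiffAt.of_le (by exact_mod_cast le_top))
      (hgs.contDiffAt.of_le (by exact_mod_cast le_top)), hf₁k, hφj j hj] at h1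
    linarith
  have hact : ∀ (Y : ℝ → Fin (d + 1) → ℝ), ContDiff ℝ ∞ Y → ∀ y,
      (laxOp (u t)).act (fun y => φ (Y y)) y = φ ((laxOp (u t)).act Y y) := by
    intro Y hY y
    simp only [DiffOp.act, map_sum, map_smul]
    exact Finset.sum_congr rfl fun j _ => by rw [iteratedDeriv_clm_comp φ hY]
  have hLf₁ : (laxOp (u t)).act f₁ = fun _ => 0 := by
    funext y
    rw [hf₁, hact _ (hs t ht), hL t ht, map_zero]
  have hQf₁ : ∀ y, b * schrodinger q f₁ y = φ (X y) := by
    intro y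
    rw [schrodinger, hf₁k]
    simp only [hX, map_smul, map_add, smul_eq_mul]
    rfl
  have hLQ : b * (laxOp (u t)).act (schrodinger q f₁) x
      = -∑ i : Fin d, D i * iteratedDeriv (i : ℕ) f₁ x := by
    have h1 := hact X hXs x
    rw [hLX, map_neg, map_sum] at h1
    simp only [map_smul, ← hf₁k, smul_eq_mul] at h1
    rw [← h1, ← funext hQf₁]
    simp only [DiffOp.act, iteratedDeriv_const_mul_field, Finset.mul_sum, smul_eq_mul]
    exact Finset.sum_congr rfl fun j _ => by ring
  have hzero : schrodinger q (fun _ => 0) x = 0 := by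
    simp [schrodinger]
  have hcomm := commutator_eq_zero_of_jet hu hq hgs hgjet
  have e1 : (laxOp (u t)).act f = fun y => (laxOp (u t)).act f₁ y + (laxOp (u t)).act g y := by
    funext y
    conv_lhs => rw [hfe]
    exact laxOp_act_add hf₁s hgs y
  have e2 : schrodinger q f = fun y => schrodinger q f₁ y + schrodinger q g y := by
    funext y
    conv_lhs => rw [hfe]
    exact schrodinger_add hf₁s hgs y
  have e3 : ∀ i : Fin d, iteratedDeriv (i : ℕ) f x = iteratedDeriv (i : ℕ) f₁ x := by
    intro i
    rw [hf₁k, hφj _ (by omega)]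
  rw [e1, schrodinger_add (contDiff_laxOp_act hu hf₁s) (contDiff_laxOp_act hu hgs), e2,
    laxOp_act_add (contDiff_schrodinger hq hf₁s) (contDiff_schrodinger hq hgs), hLf₁, hzero,
    Finset.sum_congr rfl fun i _ => by rw [e3 i]]
  linear_combination hLQ - b * hcomm

end flow

end

/-! ### Assembly of the theorem -/

theorem theorem3p11 (d : ℕ) (hd : 2 ≤ d) (χ : ChiConfig d) (hχ : χ.Nondegenerate) :
    ∃ α₁₁ α₂₂ : ℝ,
      (∀ (γ : ℝ → Projectivization ℝ (Fin (d + 1) → ℝ)) (Γ : ℝ → Fin (d + 1) → ℝ)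
          (u : Fin d → ℝ → ℝ),
        IsNormalizedLift γ Γ → HasMonodromy γ → (∀ x, (laxOp u).act Γ x = 0) →
          χ.HasExpansion γ Γ (opG₁ d α₁₁) (opG₂ d α₁₁ α₂₂ (u ⟨d - 1, by omega⟩))) ∧
      (χ.Centralized →
        ∀ (I : Set ℝ) (γ : ℝ → ℝ → Projectivization ℝ (Fin (d + 1) → ℝ))
          (Γ : ℝ → ℝ → Fin (d + 1) → ℝ) (u : ℝ → Fin d → ℝ → ℝ),
        IsOpen I →
        ContDiffOn ℝ ∞ (fun z : ℝ × ℝ => Γ z.1 z.2) (I ×ˢ Set.univ) →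
        (∀ t ∈ I, IsNormalizedLift (γ t) (Γ t) ∧ HasMonodromy (γ t) ∧
          ∀ x, (laxOp (u t)).act (Γ t) x = 0) →
        (∃ t ∈ I, opG₂ d α₁₁ α₂₂ (u t ⟨d - 1, by omega⟩) ≠ 0) →
        (∀ t ∈ I, ∀ x, HasDerivAt (fun s => Γ s x)
          ((opG₂ d α₁₁ α₂₂ (u t ⟨d - 1, by omega⟩)).act (Γ t) x) t) →
          α₂₂ ≠ 0 ∧
          IsKdVSolution 2 d ((fun τ => τ / α₂₂) ⁻¹' I) (fun τ => u (τ / α₂₂))) := by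
  refine ⟨χ.leadingCoord ⟨0, by omega⟩, χ.leadingCoord ⟨1, by omega⟩,
    fun γ Γ u hΓ hγ hL => χ.hasExpansion hd hχ hΓ hγ hL, ?_⟩
  intro hcen I γ Γ u hI hΓ hcurve hne hflow
  set a := χ.leadingCoord ⟨0, by omega⟩
  set b := χ.leadingCoord ⟨1, by omega⟩
  obtain ⟨t₀, ht₀, hG₀⟩ := hne
  -- A single curve of the family suffices, since `a` depends only on `χ`: its centralized expansion
  -- is compared with the general one.
  have ha : a = 0 := by
    obtain ⟨h1, h2, h3⟩ := hcurve t₀ ht₀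
    obtain ⟨G, hG⟩ := hcen _ _ h1 h2
    exact (χ.hasExpansion hd hχ h1 h2 h3).eq_zero_of_zero hd h1 hG
  have hb : b ≠ 0 := by
    intro hb
    apply hG₀
    funext j x
    simp [opG₂, ha, hb]
  have hs : ∀ t ∈ I, ContDiff ℝ ∞ (Γ t) := fun t ht => (hcurve t ht).1.smooth
  have hW : ∀ t ∈ I, ∀ x, curveWronskian (Γ t) x = 1 := fun t ht => (hcurve t ht).1.wronskian
  have hL : ∀ t ∈ I, ∀ x, (laxOp (u t)).act (Γ t) x = 0 := fun t ht => (hcurve t ht).2.2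
  have hus : ∀ t ∈ I, ∀ i, ContDiff ℝ ∞ (u t i) := fun t ht =>
    contDiff_laxOp_coeff (hL t ht) (hs t ht) (hW t ht)
  have hup : ∀ t ∈ I, ∀ i, Function.Periodic (u t i) (2 * Real.pi) := fun t ht =>
    periodic_laxOp_coeff (hL t ht) (hcurve t ht).1 (hcurve t ht).2.1
  have hud : ∀ t ∈ I, ∀ i x, DifferentiableAt ℝ (fun s => u s i x) t := fun t ht i x =>
    differentiableAt_laxOp_coeff hI hΓ hW hL ht i x
  -- The rescaled time contributes the factor `1/b`, which cancels the `b` in front of the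
  -- commutator.
  have hder : ∀ τ, τ / b ∈ I → ∀ i x, HasDerivAt (fun s => u (s / b) i x)
      (deriv (fun s => u s i x) (τ / b) * (1 / b)) τ := by
    intro τ hτ i x
    exact ((hud _ hτ i x).hasDerivAt).comp τ ((hasDerivAt_id τ).div_const b)
  refine ⟨hb, fun τ hτ => hus _ hτ, fun τ hτ => hup _ hτ,
    fun τ hτ i x => (hder τ hτ i x).differentiableAt, fun τ hτ => ?_⟩
  obtain ⟨R, hR, hR2⟩ := exists_isLaxRoot hd (hus _ hτ) (hup _ hτ)
  refine ⟨R, hR, fun f hf x => ?_⟩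
  set q : ℝ → ℝ := fun x => 2 / ((d : ℝ) + 1) * u (τ / b) ⟨d - 1, by omega⟩ x with hq
  have hqs : ContDiff ℝ ∞ q := contDiff_const.mul (hus _ hτ _)
  have hact : ∀ f : ℝ → ℝ, ((R.npow 2).diffPart 2).act f = schrodinger q f :=
    fun f => funext fun x => hR2 f x
  have hmain := lax_equation_of_flow hI hΓ hs hW hL (b := b) hτ hqs (fun x => by
    have := hflow _ hτ x
    rw [opG₂_act hd, ha] at this
    convert this using 1
    simp only [hq, smul_add, smul_smul]
    congr 2
    ring) hf x
  rw [hact, hact]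
  have e : ∀ i : Fin d, deriv (fun s => u (s / b) i x) τ * iteratedDeriv (i : ℕ) f x
      = (1 / b) * (deriv (fun s => u s i x) (τ / b) * iteratedDeriv (i : ℕ) f x) := by
    intro i
    rw [(hder τ hτ i x).deriv]
    ring
  rw [Finset.sum_congr rfl fun i _ => e i, ← Finset.mul_sum, hmain]
  field_simp
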